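/- **Setting.** For $n\ge 1$, a graph in $\mathcal G_n$ consists of two balanced binary trees of height $n$, whose roots are called $\mathtt{source}$ and $\mathtt{target}$, joined by an arbitrary cycle that alternates between the leaves of the two trees and visits every leaf of both trees exactly once (so it has $2^{n+2}-2$ nodes). The nodes are quantum processors. Initially a node knows $n$, the length $b$ of the data, its own identifier (identifiers are distinct and otherwise arbitrary), its degree, and whether it is $\mathtt{source}$, $\mathtt{target}$ or neither; nodes share no randomness or entanglement. Each node $u$ addresses its neighbours through port numbers $1,\dots,\deg(u)$, assigned to the neighbours by an arbitrary bijection. Besides its local register, node $u$ has an emission register $\mathsf E_{u\to v}$ and a reception register $\mathsf R_{u\leftarrow v}$ for each neighbour $v$. The basis states of a message register are bit strings, where the empty string $\perp$ stands for "no message". In each round, (1) every node applies a unitary to its own registers, the same unitary for all nodes of equal degree, which leaves its reception registers in the state $\perp$; (2) the contents of $\mathsf E_{u\to v}$ and $\mathsf R_{v\leftarrow u}$ are swapped for all ordered pairs $(u,v)$ of adjacent nodes. The message complexity of a round is the largest total length of the messages in the emission registers, over all classical configurations that have non-zero amplitude just before step (2); the message complexity of the algorithm is the sum over all its rounds. In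 the point-to-point routing problem $\mathtt{source}$ holds data of $b\ge1$ (qu)bits, and the algorithm solves it with probability at least $p$ if at the end $\mathtt{target}$ reports success with probability at least $p$ and, whenever it reports success, its output register holds exactly the data. **Theorem 1.** (a) There are quantum distributed algorithms $A_{n,b}$ ($n,b\ge 1$) and constants $C,k\in\mathbb N$ such that for all $n,b\ge1$, every graph in $\mathcal G_n$, every assignment of identifiers and port numbers and every $x\in\{0,1\}^b$, given once to $\mathtt{source}$, the algorithm $A_{n,b}$ solves the point-to-point routing problem with probability at least $1-1/\exp(n)$ and has message complexity at most $C\,b\,n^k$. (b) The same holds when the data is an arbitrary unknown pure quantum state $|\varphi\rangle$ of $b$ qubits, provided $\mathtt{source}$ holds polynomially many copies of it: there are algorithms $A_{n,b}$, each using at most $C\,n^k$ copies, and constants $C,k\in\mathbb N$ such that for all $n,b\ge1$, every graph in $\mathcal G_n$, every assignment of identifiers and port numbers and every unit vector $|\varphi\rangle\in(\mathbb C^2)^{\otimes b}$, the algorithm $A_{n,b}$ solves the point-to-point routing problem with probability at least $1-1/\exp(n)$ and has message complexity at most $C\,b\,n^k$. -/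

import Mathlib

/-! ### Networks in the port-numbering model -/

/-- A distributed network on the graph `G`, with distinguished nodes `source` and `target`:
distinct identifiers, and for every node `u` a bijection between the port numbers of `u` and the
neighbours of `u`. -/
structure Network {V : Type} [Fintype V] (G : SimpleGraph V) [DecidableRel G.Adj] where
  source : V
  target : V
  /-- identifiers -/
  ident : V → ℕ
  ident_injective : Function.Injective ident
  /-- the port numbering: `port u i` is the neighbour of `u` reached through port `i` -/
  port : ∀ u : V, Fin (G.degree u) ≃ G.neighborSet u

/-- What a node knows about its role: `source` knows that it is the source, `target` that it is the
target, and every other node that it is neither. -/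
inductive Role where
  | source
  | target
  | ordinary

/-- The role of a node. -/
def Network.role {V : Type} [Fintype V] [DecidableEq V] {G : SimpleGraph V} [DecidableRel G.Adj]
    (N : Network G) (v : V) : Role :=
  if v = N.source then Role.source else if v = N.target then Role.target else Role.ordinary

/-- If port `i` of `u` leads to `v`, this is the port of `v` that leads back to `u`. -/
def Network.backPort {V : Type} [Fintype V] {G : SimpleGraph V} [DecidableRel G.Adj]
    (N : Network G) (u : V) (i : Fin (G.degree u)) : Fin (G.degree (N.port u i : V)) :=
  (N.port (N.port u i : V)).symm ⟨u, G.adj_symm (N.port u i).2⟩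

/-! ### Quantum distributed algorithms -/

/-- Strings of `b` bits. They index the computational basis of a `b`-qubit register. -/
abbrev Bits (b : ℕ) : Type := Fin b → Bool

/-- The classical contents of a message register: the bit strings of length at most `L`. -/
abbrev Msg (L : ℕ) : Type := (k : Fin (L + 1)) × (Fin (k : ℕ) → Bool)

/-- The size (number of bits) of a message. -/
def Msg.size {L : ℕ} (m : Msg L) : ℕ := (m.1 : ℕ)

/-- The empty message `⊥`, the only message of size `0`: nothing is sent. -/
def Msg.empty (L : ℕ) : Msg L := ⟨0, fun _ => false⟩

/-- A classical configuration of one node of degree `d`: the contents of its local register (which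
consists of a work register, `K` input registers of `b` bits, and an output register that holds
either nothing or a `b`-bit string), of its `d` emission registers, and of its `d` reception
registers. -/
structure NodeConf (W : Type) (b K L d : ℕ) where
  work : W
  input : Fin K → Bits b
  output : Option (Bits b)
  emit : Fin d → Msg L
  recv : Fin d → Msg L
deriving DecidableEq

instance (W : Type) [Fintype W] (b K L d : ℕ) : Fintype (NodeConf W b K L d) :=
  Fintype.ofEquiv (W × (Fin K → Bits b) × Option (Bits b) × (Fin d → Msg L) × (Fin d → Msg L))
    { toFun := fun t => ⟨t.1, t.2.1, t.2.2.1, t.2.2.2.1, t.2.2.2.2⟩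
      invFun := fun x => (x.work, x.input, x.output, x.emit, x.recv)
      left_inv := fun _ => rfl
      right_inv := fun _ => rfl }

/-- A quantum distributed algorithm for data of `b` (qu)bits.

In every round each node applies to its registers a unitary, which is the same for all the nodes of
the same degree (nodes of different degrees have different sets of registers). What a node knows
initially, besides its degree, is its identifier and its role, which determine the initial content
of its work register. -/
structure QAlgorithm (b : ℕ) where
  /-- the computational basis of the work register of a node -/
  Work : Type
  [fintypeWork : Fintype Work]
  [decidableEqWork : DecidableEq Work]
  /-- the number of copies of the data that `source` receives -/
  copies : ℕ
  /-- an upper bound on the length of a single message -/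
  maxLen : ℕ
  /-- the number of rounds -/
  rounds : ℕ
  /-- the initial content of the work register, given the identifier and the role -/
  init : ℕ → Role → Work
  /-- the local unitary of round `r` for nodes of degree `d` -/
  op : ∀ _r d : ℕ, Matrix.unitaryGroup (NodeConf Work b copies maxLen d) ℂ
  /-- When the messages are about to be sent, the reception registers have been emptied, in order to
  prepare for the next reception: if the emission registers are empty before the local unitary, then
  the reception registers are empty after it. -/
  op_clears : ∀ (r d : ℕ) (x y : NodeConf Work b copies maxLen d),
    (∀ i, x.emit i = Msg.empty maxLen) → (∃ i, y.recv i ≠ Msg.empty maxLen) →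
      (op r d : Matrix (NodeConf Work b copies maxLen d) (NodeConf Work b copies maxLen d) ℂ) y x = 0

attribute [instance] QAlgorithm.fintypeWork QAlgorithm.decidableEqWork

namespace QAlgorithm

variable {b : ℕ} (A : QAlgorithm b) {V : Type} [Fintype V] [DecidableEq V]
  {G : SimpleGraph V} [DecidableRel G.Adj]

/-- A classical configuration of the whole network. -/
abbrev Config (G : SimpleGraph V) [DecidableRel G.Adj] : Type :=
  ∀ v : V, NodeConf A.Work b A.copies A.maxLen (G.degree v)

/-- A (quantum) state of the whole network: the amplitude of each classical configuration. -/
abbrev State (G : SimpleGraph V) [DecidableRel G.Adj] : Type := A.Config G → ℂ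

/-- The initial state, a product state: the work register of each node holds its initial content,
the input registers of `source` hold the copies of the data `φ`, the input registers of all other
nodes are blank, and all output, emission and reception registers are empty. -/
noncomputable def initState (N : Network G) (φ : EuclideanSpace ℂ (Bits b)) : A.State G :=
  fun c => ∏ v : V,
    if (c v).work = A.init (N.ident v) (N.role v) ∧ (c v).output = none ∧
        (∀ i, (c v).emit i = Msg.empty A.maxLen) ∧ (∀ i, (c v).recv i = Msg.empty A.maxLen) then
      if v = N.source then ∏ k, φ ((c v).input k)
      else if ∀ k i, (c v).input k i = false then 1 else 0
    else 0

/-- Step (1) of round `r`: every node applies its local unitary to its registers (the tensor product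
over all nodes of the local unitaries is applied to the state). -/
noncomputable def localStep (r : ℕ) (ψ : A.State G) : A.State G :=
  fun c => ∑ c' : A.Config G, (∏ v : V, (A.op r (G.degree v)).1 (c v) (c' v)) * ψ c'

/-- Sending the messages, on classical configurations: for every edge `{u, v}`, the contents of the
emission register of `u` towards `v` and of the reception register of `v` from `u` are swapped. -/
def deliver (N : Network G) (c : A.Config G) : A.Config G :=
  fun u => { c u with
    emit := fun i => (c (N.port u i)).recv (N.backPort u i)
    recv := fun i => (c (N.port u i)).emit (N.backPort u i) }

/-- The state before round `r` (rounds are numbered from `0`). As `deliver` is an involution,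
precomposition with it is step (2) of a round, the sending of the messages. -/
noncomputable def state (N : Network G) (φ : EuclideanSpace ℂ (Bits b)) : ℕ → A.State G
  | 0 => A.initState N φ
  | r + 1 => fun c => A.localStep r (state N φ r) (A.deliver N c)

/-- The message complexity of a classical configuration: the total size of the messages in the
emission registers. -/
def configCost (c : A.Config G) : ℕ := ∑ v : V, ∑ i, ((c v).emit i).size

open Classical in
/-- The message complexity of round `r`: the largest message complexity of a classical configuration
that has a non-zero amplitude just before the messages are sent. -/
noncomputable def roundCost (N : Network G) (φ : EuclideanSpace ℂ (Bits b)) (r : ℕ) : ℕ :=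
  (Finset.univ.filter fun c : A.Config G => A.localStep r (A.state N φ r) c ≠ 0).sup A.configCost

/-- The message complexity of the algorithm: the sum of those of all its rounds. -/
noncomputable def messageComplexity (N : Network G) (φ : EuclideanSpace ℂ (Bits b)) : ℕ :=
  ∑ r ∈ Finset.range A.rounds, A.roundCost N φ r

/-- The state at the end of the algorithm. -/
noncomputable def finalState (N : Network G) (φ : EuclideanSpace ℂ (Bits b)) : A.State G :=
  A.state N φ A.rounds

/-- The probability that `target`, at the end, reports success, i.e. that the measurement whether its
output register is non-empty gives the answer yes. -/
noncomputable def successProb (N : Network G) (φ : EuclideanSpace ℂ (Bits b)) : ℝ :=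
  ∑ c : A.Config G, if ((c N.target).output).isSome then ‖A.finalState N φ c‖ ^ 2 else 0

/-- The configuration `c` with the output register of `target` emptied. -/
def eraseOutput (N : Network G) (c : A.Config G) : A.Config G :=
  Function.update c N.target { c N.target with output := none }

/-- If `target` reports success, then its output register holds exactly the state `φ`: the
(unnormalised) post-measurement state is the product of `φ`, on the output register of `target`, and
of some state `χ` of all the other registers. -/
def OutputsOnSuccess (N : Network G) (φ : EuclideanSpace ℂ (Bits b)) : Prop :=
  ∃ χ : A.Config G → ℂ, ∀ (c : A.Config G) (y : Bits b), (c N.target).output = some y →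
    A.finalState N φ c = φ y * χ (A.eraseOutput N c)

/-- With probability at least `p` the algorithm solves point-to-point routing of the data `φ` on the
network `N`: `target` reports success with probability at least `p`, and then it holds `φ`. -/
def SolvesRouting (N : Network G) (φ : EuclideanSpace ℂ (Bits b)) (p : ℝ) : Prop :=
  p ≤ A.successProb N φ ∧ A.OutputsOnSuccess N φ

end QAlgorithm

/-! ### Welded trees -/

/-- The nodes of two balanced binary trees of height `n`. The left tree has side `false`, the right
tree has side `true`; at depth `k` each tree has `2 ^ k` nodes, and the children of the node at
position `j` are those at positions `2 * j` and `2 * j + 1` of the next depth. -/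
structure WeldedNode (n : ℕ) where
  side : Bool
  depth : Fin (n + 1)
  pos : Fin (2 ^ (depth : ℕ))
deriving DecidableEq, Fintype

/-- The root of a tree. -/
def WeldedNode.root (n : ℕ) (side : Bool) : WeldedNode n := ⟨side, 0, ⟨0, by simp⟩⟩

/-- The leaves of a tree. -/
def WeldedNode.leaf {n : ℕ} (side : Bool) (j : Fin (2 ^ n)) : WeldedNode n := ⟨side, Fin.last n, j⟩

/-- `v` is a child of `u` in one of the two trees. -/
def WeldedNode.IsChild {n : ℕ} (u v : WeldedNode n) : Prop :=
  v.side = u.side ∧ (v.depth : ℕ) = u.depth + 1 ∧ (v.pos : ℕ) / 2 = u.pos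

/-- The welded trees with the cycle `ℓ 0, r 0, ℓ 1, r 1, …, ℓ (2 ^ n - 1), r (2 ^ n - 1), ℓ 0`, which
alternates between the leaves of the left tree (enumerated by `ℓ`) and those of the right tree
(enumerated by `r`). The addition `i + 1` is modulo `2 ^ n`. -/
def weldedTrees (n : ℕ) (ℓ r : Equiv.Perm (Fin (2 ^ n))) : SimpleGraph (WeldedNode n) :=
  SimpleGraph.fromRel fun u v =>
    u.IsChild v ∨
    (∃ i, u = WeldedNode.leaf false (ℓ i) ∧ v = WeldedNode.leaf true (r i)) ∨
    (∃ i, u = WeldedNode.leaf true (r i) ∧ v = WeldedNode.leaf false (ℓ (i + 1)))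

instance (n : ℕ) (ℓ r : Equiv.Perm (Fin (2 ^ n))) : DecidableRel (weldedTrees n ℓ r).Adj := by
  unfold weldedTrees WeldedNode.IsChild
  intro u v
  simp only [SimpleGraph.fromRel_adj]
  infer_instance

/-- A network over a graph of the family `𝒢_n`: the source and the target are the two roots, whereas
the identifiers and the port numbering are arbitrary. -/
def IsWeldedNetwork {n : ℕ} {ℓ r : Equiv.Perm (Fin (2 ^ n))} (N : Network (weldedTrees n ℓ r)) :
    Prop :=
  N.source = WeldedNode.root n false ∧ N.target = WeldedNode.root n true

/-!
A single walker carries the data from `source` to `target`: in every computational basis state of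
the network at most one message is under way, so that the message complexity is at most the number
of rounds times the length of a message, although the walker spreads over exponentially many nodes
in superposition. One copy of the data suffices and the algorithm succeeds with certainty, for
classical and for quantum data alike.

*The walk.* Every node reflects the walker about the uniform superposition of its ports, then the
messages are sent. This walk is governed by the transition operator `P` of the simple random walk
on the graph: the amplitude that leads from the ports of `source` to those of `target` in `t` steps
is, up to sign, the entry of the Chebyshev polynomial `T_t(P)` between the two nodes
(`portVec_dotProduct_walkOp`). On functions of the column, the distance from `source`, `P` is the
transition operator of a birth-death chain on `0, …, 2 * n + 1` (`avgOp_column`).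

*The hitting amplitude* (`exists_hitAmplitude_ge`). Let `R` be the polynomial of degree `2 * n + 1`
with `R(P) δ_0 = δ_(2n+1)`, and `h` any polynomial. As the chain looks the same from both ends,
`((R h)(P) δ_0)(2n+1) = (h(P) δ_0)(0)`: arriving with `R h` is returning with `h`. If `R h` is
bounded on `[-1, 1]`, its Chebyshev coefficients are bounded, and then some `T_t(P)` with
`t ≤ deg (R h)` has an entry comparable to `(h(P) δ_0)(0)`. The polynomial `R` is polynomially
bounded in the band `x ^ 2 ≤ 8 / 9` and grows at most like `2 ^ n` outside of it, which the factor
`h = (1 - X ^ 2) ^ (2 * (n / 2))` compensates (`abs_eval_dampedArrivalPoly_le`). The return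
amplitude `(h(P) δ_0)(0)` is of order `1 / n` by Cauchy-Schwarz with a function on the left tree
that `P` annihilates up to the leaves (`return_amplitude_ge`).

*Amplification* (`walkState_final`). With its coins between the moves, a walk of `t` steps is a
palindrome of involutions, hence an involution itself, so the walk also undoes the walk.
Alternating reflections at `target` and at `source`, separated by walks, rotate the state of the
walker in a plane. Because the hitting amplitude depends on `n` only, `source` can adjust the
initial amplitude such that after polynomially many walks the rotation ends exactly at `target`.

*The network.* The local unitary of a node is a reflection on the span of the configurations where
the walker is at that node, and fixes the idle configuration. Therefore the global state remains a
superposition of configurations with exactly one walker, and evolves like the walk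
(`state_eq`).
-/

open Polynomial

/-! ### Chebyshev expansions of bounded polynomials -/

theorem exists_chebyshev_expansion (d : ℕ) (q : ℝ[X]) (hq : q.natDegree ≤ d) :
    ∃ c : ℕ → ℝ, q = ∑ t ∈ Finset.range (d + 1), c t • Chebyshev.T ℝ t := by
  induction d generalizing q with
  | zero =>
    refine ⟨fun _ => q.coeff 0, ?_⟩
    rw [eq_C_of_natDegree_le_zero hq]
    simp [smul_eq_C_mul]
  | succ d ih =>
    have hT : (Chebyshev.T ℝ ((d + 1 : ℕ) : ℤ)).natDegree = d + 1 := by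
      rw [Chebyshev.natDegree_T]; rfl
    have hlc : (Chebyshev.T ℝ ((d + 1 : ℕ) : ℤ)).coeff (d + 1) ≠ 0 := by
      have h := Chebyshev.T_ne_zero ℝ ((d + 1 : ℕ) : ℤ)
      rw [← leadingCoeff_ne_zero, leadingCoeff, hT] at h
      exact h
    set a := q.coeff (d + 1) / (Chebyshev.T ℝ ((d + 1 : ℕ) : ℤ)).coeff (d + 1) with ha
    obtain ⟨c, hc⟩ := ih (q - a • Chebyshev.T ℝ ((d + 1 : ℕ) : ℤ)) (by
      rw [natDegree_le_iff_coeff_eq_zero]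
      intro N hN
      rcases Nat.lt_or_ge (d + 1) N with h | h
      · rw [coeff_sub, coeff_smul, coeff_eq_zero_of_natDegree_lt (hq.trans_lt h),
          coeff_eq_zero_of_natDegree_lt (hT.trans_lt h)]
        simp
      · obtain rfl : N = d + 1 := by omega
        rw [coeff_sub, coeff_smul, ha, smul_eq_mul, div_mul_cancel₀ _ hlc, sub_self])
    refine ⟨fun t => if t = d + 1 then a else c t, ?_⟩
    rw [Finset.sum_range_succ]
    beta_reduce
    rw [if_pos rfl, Finset.sum_congr rfl (g := fun t => c t • Chebyshev.T ℝ (t : ℤ))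
      (fun t ht => by rw [if_neg (by have := Finset.mem_range.1 ht; omega)]), ← hc]
    abel

theorem abs_integral_measureT_le {f : ℝ → ℝ} {B : ℝ} (hf : ∀ x, |x| ≤ 1 → |f x| ≤ B) :
    |∫ x, f x ∂Chebyshev.measureT| ≤ B * Real.pi := by
  rw [Chebyshev.integral_measureT_eq_integral_cos]
  have := intervalIntegral.norm_integral_le_of_norm_le_const (a := 0) (b := Real.pi) (C := B)
    (f := fun θ => f (Real.cos θ)) (fun θ _ => hf _ (Real.abs_cos_le_one θ))
  rwa [sub_zero, abs_of_pos Real.pi_pos] at this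

theorem abs_chebyshev_coeff_le {d : ℕ} {c : ℕ → ℝ} {B : ℝ}
    (hB : ∀ x : ℝ, |x| ≤ 1 →
      |(∑ t ∈ Finset.range (d + 1), c t • Chebyshev.T ℝ t : ℝ[X]).eval x| ≤ B)
    {t : ℕ} (ht : t ≤ d) : |c t| ≤ 2 * B := by
  have hB0 : 0 ≤ B := (abs_nonneg _).trans (hB 0 (by simp))
  set q : ℝ[X] := ∑ t ∈ Finset.range (d + 1), c t • Chebyshev.T ℝ t with hq
  have key : ∫ x, q.eval x * (Chebyshev.T ℝ t).eval x ∂Chebyshev.measureT =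
      c t * ∫ x, (Chebyshev.T ℝ t).eval x * (Chebyshev.T ℝ t).eval x ∂Chebyshev.measureT := by
    have h1 : ∀ x : ℝ, q.eval x * (Chebyshev.T ℝ t).eval x =
        ∑ s ∈ Finset.range (d + 1),
          c s * ((Chebyshev.T ℝ s).eval x * (Chebyshev.T ℝ t).eval x) := by
      intro x
      rw [hq, eval_finsetSum, Finset.sum_mul]
      refine Finset.sum_congr rfl fun s _ => ?_
      rw [eval_smul, smul_eq_mul, mul_assoc]
    simp_rw [h1]
    rw [MeasureTheory.integral_finsetSum]
    · rw [Finset.sum_eq_single t]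
      · rw [MeasureTheory.integral_const_mul]
      · intro s _ hs
        rw [MeasureTheory.integral_const_mul,
          Chebyshev.integral_eval_T_real_mul_eval_T_real_measureT_of_ne hs, mul_zero]
      · intro h
        exact absurd (Finset.mem_range.2 (by omega)) h
    · intro s _
      exact Chebyshev.integrable_measureT (by fun_prop)
  have hpi := Real.pi_pos
  have hbd : |∫ x, q.eval x * (Chebyshev.T ℝ t).eval x ∂Chebyshev.measureT| ≤ B * Real.pi := by
    refine abs_integral_measureT_le fun x hx => ?_
    rw [abs_mul]
    calc |q.eval x| * |(Chebyshev.T ℝ t).eval x| ≤ B * 1 :=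
          mul_le_mul (hB x hx) (Chebyshev.abs_eval_T_real_le_one _ hx) (abs_nonneg _) hB0
      _ = B := mul_one B
  rw [key] at hbd
  have hlow : Real.pi / 2 ≤
      ∫ x, (Chebyshev.T ℝ t).eval x * (Chebyshev.T ℝ t).eval x ∂Chebyshev.measureT := by
    rcases Nat.eq_zero_or_pos t with rfl | h
    · have := Chebyshev.integral_eval_T_real_mul_self_measureT_zero
      simp only [Nat.cast_zero]
      rw [this]; linarith
    · rw [Chebyshev.integral_T_real_mul_self_measureT_of_ne_zero h.ne']
  rw [abs_mul, abs_of_pos (lt_of_lt_of_le (by positivity) hlow)] at hbd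
  have : |c t| * (Real.pi / 2) ≤ B * Real.pi :=
    (mul_le_mul_of_nonneg_left hlow (abs_nonneg _)).trans hbd
  nlinarith

/-- A linear functional that is large on a polynomial bounded on `[-1, 1]` is large on some
Chebyshev polynomial of at most the same degree. -/
theorem exists_chebyshev_large (Λ : ℝ[X] →ₗ[ℝ] ℝ) (d : ℕ) (q : ℝ[X]) (hq : q.natDegree ≤ d)
    {B : ℝ} (hB : ∀ x : ℝ, |x| ≤ 1 → |q.eval x| ≤ B) :
    ∃ t ≤ d, |Λ q| ≤ 2 * B * (d + 1) * |Λ (Chebyshev.T ℝ t)| := by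
  obtain ⟨c, rfl⟩ := exists_chebyshev_expansion d q hq
  have hB0 : 0 ≤ B := (abs_nonneg _).trans (hB 0 (by simp))
  by_contra! h
  obtain ⟨s, hs, hmax⟩ := Finset.exists_max_image (Finset.range (d + 1))
    (fun t : ℕ => |Λ (Chebyshev.T ℝ t)|) ⟨0, by simp⟩
  have hs' : s ≤ d := Nat.lt_succ_iff.1 (Finset.mem_range.1 hs)
  refine absurd (h s hs') (not_lt.2 ?_)
  rw [map_sum]
  calc |∑ t ∈ Finset.range (d + 1), Λ (c t • Chebyshev.T ℝ t)|
      ≤ ∑ t ∈ Finset.range (d + 1), |Λ (c t • Chebyshev.T ℝ t)| := Finset.abs_sum_le_sum_abs _ _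
    _ ≤ ∑ t ∈ Finset.range (d + 1), 2 * B * |Λ (Chebyshev.T ℝ s)| := by
        refine Finset.sum_le_sum fun t ht => ?_
        rw [map_smul, smul_eq_mul, abs_mul]
        exact mul_le_mul (abs_chebyshev_coeff_le hB (Nat.lt_succ_iff.1 (Finset.mem_range.1 ht)))
          (hmax t ht) (abs_nonneg _) (by positivity)
    _ = _ := by simp; ring

/-! ### The birth-death chain of the columns of the welded trees -/

/-- The probability that the simple random walk on the welded trees moves from column `j` to
column `j + 1`. The columns are `0, …, 2 * n + 1`, from `source` to `target`; at all further
indices the value is `0`. -/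
noncomputable def stepUp (n j : ℕ) : ℝ :=
  if j = 0 then 1 else if j ≤ n then 2 / 3 else if j ≤ 2 * n then 1 / 3 else 0

/-- The probability that the simple random walk on the welded trees moves from column `j` to
column `j - 1`. -/
noncomputable def stepDown (n j : ℕ) : ℝ :=
  if j = 0 then 0 else if j ≤ n then 1 / 3 else if j ≤ 2 * n then 2 / 3
  else if j = 2 * n + 1 then 1 else 0

/-- The transition operator of the simple random walk on the welded trees, on functions of the
column. It sends every function to one that is supported on the columns `0, …, 2 * n + 1`. -/
noncomputable def colOp (n : ℕ) : Module.End ℝ (ℕ → ℝ) where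
  toFun H j := stepDown n j * H (j - 1) + stepUp n j * H (j + 1)
  map_add' H K := by ext j; simp only [Pi.add_apply]; ring
  map_smul' c H := by ext j; simp only [Pi.smul_apply, smul_eq_mul, RingHom.id_apply]; ring

theorem colOp_apply (n : ℕ) (H : ℕ → ℝ) (j : ℕ) :
    colOp n H j = stepDown n j * H (j - 1) + stepUp n j * H (j + 1) := rfl

/-- The total degree of column `j`: the reversible measure of the chain. -/
noncomputable def colWeight (n j : ℕ) : ℝ :=
  if j = 0 then 2 else if j ≤ n then 3 * 2 ^ j else if j ≤ 2 * n then 3 * 2 ^ (2 * n + 1 - j) else 2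

theorem colWeight_pos (n j : ℕ) : 0 < colWeight n j := by
  unfold colWeight; split_ifs <;> positivity

theorem colWeight_detailed_balance {n j : ℕ} (hn : 1 ≤ n) (hj : j ≤ 2 * n) :
    colWeight n (j + 1) * stepDown n (j + 1) = colWeight n j * stepUp n j := by
  unfold colWeight stepDown stepUp
  rcases Nat.eq_zero_or_pos j with rfl | h0
  · simp [hn]; norm_num
  rcases Nat.lt_trichotomy j n with h | rfl | h
  · simp [h0.ne', h.le, Nat.succ_le_of_lt h, pow_succ]; ring
  · have h1 : j + 1 ≤ 2 * j := by omega
    have h2 : 2 * j + 1 - (j + 1) = j := by omega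
    simp [h0.ne', h1, h2]
  · have h1 : ¬ j ≤ n := by omega
    have h2 : ¬ j + 1 ≤ n := by omega
    rcases Nat.lt_or_ge j (2 * n) with h3 | h3
    · have h4 : 2 * n + 1 - j = (2 * n - j) + 1 := by omega
      have h5 : 2 * n + 1 - (j + 1) = 2 * n - j := by omega
      simp [h0.ne', h1, h2, hj, Nat.succ_le_of_lt h3, h4, h5, pow_succ]; ring
    · obtain rfl : j = 2 * n := by omega
      simp [h1, h2, h0.ne']; norm_num

/-- The inner product on functions of the column, weighted by the reversible measure. -/
noncomputable def colInner (n : ℕ) (H K : ℕ → ℝ) : ℝ :=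
  ∑ j ∈ Finset.range (2 * n + 2), colWeight n j * (H j * K j)

theorem colInner_colOp {n : ℕ} (hn : 1 ≤ n) (H K : ℕ → ℝ) :
    colInner n (colOp n H) K = colInner n H (colOp n K) := by
  have key : ∀ H K : ℕ → ℝ, colInner n (colOp n H) K =
      ∑ j ∈ Finset.range (2 * n + 1),
        colWeight n j * stepUp n j * (H j * K (j + 1) + H (j + 1) * K j) := by
    intro H K
    have h1 : colInner n (colOp n H) K =
        ∑ j ∈ Finset.range (2 * n + 2), colWeight n j * stepDown n j * (H (j - 1) * K j) +
        ∑ j ∈ Finset.range (2 * n + 2), colWeight n j * stepUp n j * (H (j + 1) * K j) := by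
      rw [← Finset.sum_add_distrib]
      refine Finset.sum_congr rfl fun j _ => ?_
      rw [colOp_apply]; ring
    have h2 : stepDown n 0 = 0 := by simp [stepDown]
    have h3 : stepUp n (2 * n + 1) = 0 := by
      unfold stepUp
      rw [if_neg (by omega), if_neg (by omega), if_neg (by omega)]
    rw [h1, Finset.sum_range_succ', Finset.sum_range_succ _ (2 * n + 1), h2, h3]
    simp only [mul_zero, zero_mul, add_zero]
    rw [← Finset.sum_add_distrib]
    refine Finset.sum_congr rfl fun j hj => ?_
    rw [colWeight_detailed_balance hn (by have := Finset.mem_range.1 hj; omega),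
      Nat.add_sub_cancel]
    ring
  have hcomm : ∀ H K : ℕ → ℝ, colInner n H K = colInner n K H := fun H K =>
    Finset.sum_congr rfl fun j _ => by ring
  rw [key, hcomm H, key]
  exact Finset.sum_congr rfl fun j _ => by ring

theorem colInner_self_nonneg (n : ℕ) (H : ℕ → ℝ) : 0 ≤ colInner n H H :=
  Finset.sum_nonneg fun j _ => mul_nonneg (colWeight_pos n j).le (mul_self_nonneg _)

theorem colInner_sq_le (n : ℕ) (H K : ℕ → ℝ) :
    colInner n H K ^ 2 ≤ colInner n H H * colInner n K K := by
  have h := Finset.sum_mul_sq_le_sq_mul_sq (Finset.range (2 * n + 2))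
    (fun j => √(colWeight n j) * H j) (fun j => √(colWeight n j) * K j)
  have e : ∀ H K : ℕ → ℝ, colInner n H K = ∑ j ∈ Finset.range (2 * n + 2),
      (√(colWeight n j) * H j) * (√(colWeight n j) * K j) := fun H K =>
    Finset.sum_congr rfl fun j _ => by
      have := Real.mul_self_sqrt (colWeight_pos n j).le
      linear_combination (-(H j * K j)) * this
  have e' : ∀ H : ℕ → ℝ, colInner n H H = ∑ j ∈ Finset.range (2 * n + 2),
      (√(colWeight n j) * H j) ^ 2 := fun H => by
    rw [e]; exact Finset.sum_congr rfl fun j _ => by ring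
  rwa [← e, ← e', ← e'] at h

theorem colInner_aeval {n : ℕ} (hn : 1 ≤ n) (p : ℝ[X]) (H K : ℕ → ℝ) :
    colInner n (aeval (colOp n) p H) K = colInner n H (aeval (colOp n) p K) := by
  have hadd : ∀ H H' K : ℕ → ℝ, colInner n (H + H') K = colInner n H K + colInner n H' K :=
    fun H H' K => by
      simp only [colInner, Pi.add_apply, ← Finset.sum_add_distrib]
      exact Finset.sum_congr rfl fun j _ => by ring
  have hadd' : ∀ H K K' : ℕ → ℝ, colInner n H (K + K') = colInner n H K + colInner n H K' :=
    fun H K K' => by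
      simp only [colInner, Pi.add_apply, ← Finset.sum_add_distrib]
      exact Finset.sum_congr rfl fun j _ => by ring
  induction p using Polynomial.induction_on' with
  | add p q hp hq => rw [map_add, LinearMap.add_apply, LinearMap.add_apply, hadd, hadd', hp, hq]
  | monomial k a =>
    have hpow : ∀ H K : ℕ → ℝ,
        colInner n ((colOp n ^ k) H) K = colInner n H ((colOp n ^ k) K) := by
      induction k with
      | zero => intro H K; rfl
      | succ k ih =>
        intro H K
        rw [pow_succ, Module.End.mul_apply, ih, colInner_colOp hn, ← Module.End.mul_apply,
          ← pow_succ', pow_succ]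
    rw [aeval_monomial, Algebra.algebraMap_eq_smul_one, smul_mul_assoc, one_mul,
      LinearMap.smul_apply, LinearMap.smul_apply]
    have e1 : ∀ H K : ℕ → ℝ, colInner n (a • H) K = a * colInner n H K := fun H K => by
      simp only [colInner, Finset.mul_sum, Pi.smul_apply, smul_eq_mul]
      exact Finset.sum_congr rfl fun j _ => by ring
    have e2 : ∀ H K : ℕ → ℝ, colInner n H (a • K) = a * colInner n H K := fun H K => by
      simp only [colInner, Finset.mul_sum, Pi.smul_apply, smul_eq_mul]
      exact Finset.sum_congr rfl fun j _ => by ring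
    rw [e1, e2, hpow]

/-- The chain looks the same from both ends: its transition operator commutes with the reflection
`j ↦ 2 * n + 1 - j` of the columns. -/
theorem colOp_reflect {n : ℕ} {H K : ℕ → ℝ}
    (h : ∀ j ≤ 2 * n + 1, K j = H (2 * n + 1 - j)) {j : ℕ} (hj : j ≤ 2 * n + 1) :
    colOp n K j = colOp n H (2 * n + 1 - j) := by
  rw [colOp_apply, colOp_apply]
  have e1 : stepDown n j = stepUp n (2 * n + 1 - j) := by
    unfold stepDown stepUp; split_ifs <;> first | rfl | omega
  have e2 : stepUp n j = stepDown n (2 * n + 1 - j) := by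
    unfold stepDown stepUp; split_ifs <;> first | rfl | omega
  rw [← e1, ← e2, add_comm]
  congr 1
  · rcases Nat.lt_or_ge j (2 * n + 1) with h' | h'
    · rw [h _ (by omega)]; congr 2
    · obtain rfl : j = 2 * n + 1 := by omega
      have : stepUp n (2 * n + 1) = 0 := by
        unfold stepUp; rw [if_neg (by omega), if_neg (by omega), if_neg (by omega)]
      rw [this, zero_mul, zero_mul]
  · rcases Nat.eq_zero_or_pos j with rfl | h'
    · simp [stepDown]
    · rw [h _ (by omega)]; congr 2; omega

theorem aeval_colOp_reflect {n : ℕ} (p : ℝ[X]) {H K : ℕ → ℝ}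
    (h : ∀ j ≤ 2 * n + 1, K j = H (2 * n + 1 - j)) {j : ℕ} (hj : j ≤ 2 * n + 1) :
    aeval (colOp n) p K j = aeval (colOp n) p H (2 * n + 1 - j) := by
  induction p using Polynomial.induction_on' with
  | add p q hp hq =>
    simp only [map_add, LinearMap.add_apply, Pi.add_apply]
    rw [hp, hq]
  | monomial k a =>
    have hpow : ∀ j ≤ 2 * n + 1, (colOp n ^ k) K j = (colOp n ^ k) H (2 * n + 1 - j) := by
      induction k with
      | zero => exact h
      | succ k ih =>
        intro j hj
        rw [pow_succ', Module.End.mul_apply, Module.End.mul_apply]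
        exact colOp_reflect ih hj
    rw [aeval_monomial, Algebra.algebraMap_eq_smul_one, smul_mul_assoc, one_mul]
    simp only [LinearMap.smul_apply, Pi.smul_apply]
    rw [hpow j hj]

/-! ### Polynomials that carry one end of the chain to the other -/

/-- The polynomials `R j` with `R j (P) δ₀ = δ_j`, where `P` is the transition operator. -/
noncomputable def arrivalPoly (n : ℕ) : ℕ → ℝ[X]
  | 0 => 1
  | 1 => C (stepDown n 1)⁻¹ * X
  | j + 2 =>
    C (stepDown n (j + 2))⁻¹ * (X * arrivalPoly n (j + 1) - C (stepUp n j) * arrivalPoly n j)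

theorem arrivalPoly_natDegree_le (n j : ℕ) : (arrivalPoly n j).natDegree ≤ j := by
  induction j using Nat.strong_induction_on with
  | _ j ih =>
    match j with
    | 0 => simp [arrivalPoly]
    | 1 =>
      rw [arrivalPoly]
      exact (natDegree_C_mul_le _ _).trans natDegree_X_le
    | j + 2 =>
      rw [arrivalPoly]
      refine (natDegree_C_mul_le _ _).trans ((natDegree_sub_le _ _).trans (max_le ?_ ?_))
      · refine natDegree_mul_le.trans ?_
        have := ih (j + 1) (by omega)
        have := natDegree_X_le (R := ℝ)
        omega
      · refine (natDegree_C_mul_le _ _).trans ((ih j (by omega)).trans (by omega))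

theorem stepDown_ne_zero {n j : ℕ} (h0 : 1 ≤ j) (hj : j ≤ 2 * n + 1) : stepDown n j ≠ 0 := by
  unfold stepDown
  rw [if_neg (by omega)]
  split_ifs <;> first | omega | norm_num

theorem aeval_arrivalPoly {n j : ℕ} (hj : j ≤ 2 * n + 1) :
    aeval (colOp n) (arrivalPoly n j) (Pi.single 0 1) = (Pi.single j 1 : ℕ → ℝ) := by
  induction j using Nat.strong_induction_on with
  | _ j ih =>
    match j with
    | 0 => simp [arrivalPoly]
    | 1 =>
      ext i
      simp only [arrivalPoly, map_mul, aeval_C, aeval_X, Module.End.mul_apply,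
        Module.algebraMap_end_apply, Pi.smul_apply, smul_eq_mul, colOp_apply]
      rcases Nat.lt_trichotomy i 1 with h | rfl | h
      · obtain rfl : i = 0 := by omega
        simp [stepDown]
      · simp [stepDown_ne_zero le_rfl hj]
      · simp [show i - 1 ≠ 0 by omega, show i ≠ 1 by omega]
    | j + 2 =>
      ext i
      simp only [arrivalPoly, map_mul, aeval_C, aeval_X, Module.End.mul_apply, map_sub,
        Module.algebraMap_end_apply, Pi.smul_apply, smul_eq_mul, LinearMap.sub_apply,
        Pi.sub_apply, ih (j + 1) (by omega) (by omega), ih j (by omega) (by omega), colOp_apply]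
      have h2 := stepDown_ne_zero (n := n) (j := j + 2) (by omega) hj
      by_cases h : i = j + 2
      · subst h
        simp [h2]
      · by_cases h' : i = j
        · subst h'
          simp [show i - 1 ≠ i + 1 by omega]
        · by_cases h0 : i = 0
          · subst h0
            rw [show stepDown n 0 = 0 from if_pos rfl]
            simp [show j ≠ 0 from fun e => h' e.symm]
          · simp [h, h', show i - 1 ≠ j + 1 by omega]

/-- A linear recurrence of order two with characteristic roots `α` and `β`, where `β` is not the
larger one, grows at most like `k * ‖α‖ ^ k`. -/
theorem norm_le_of_linear_recurrence {u : ℕ → ℂ} {α β : ℂ} {K : ℕ} (hβ : ‖β‖ ≤ ‖α‖)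
    (hu : ∀ k, k + 2 ≤ K → u (k + 2) = (α + β) * u (k + 1) - α * β * u k) {k : ℕ} (hk : k ≤ K) :
    ‖α‖ * ‖u k‖ ≤ ‖α‖ ^ k * (‖α‖ * ‖u 0‖ + k * ‖u 1 - α * u 0‖) := by
  have hv : ∀ k, k + 1 ≤ K → ‖u (k + 1) - α * u k‖ ≤ ‖α‖ ^ k * ‖u 1 - α * u 0‖ := by
    intro k
    induction k with
    | zero => intro _; simp
    | succ k ih =>
      intro hk
      have e : u (k + 1 + 1) - α * u (k + 1) = β * (u (k + 1) - α * u k) := by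
        rw [hu k (by omega)]; ring
      rw [e, norm_mul, pow_succ', mul_assoc]
      exact mul_le_mul hβ (ih (by omega)) (norm_nonneg _) (norm_nonneg _)
  induction k with
  | zero => simp
  | succ k ih =>
    have h1 : ‖u (k + 1)‖ ≤ ‖α‖ * ‖u k‖ + ‖α‖ ^ k * ‖u 1 - α * u 0‖ := by
      have := norm_add_le (α * u k) (u (k + 1) - α * u k)
      rw [add_sub_cancel, norm_mul] at this
      exact this.trans (by gcongr; exact hv k hk)
    calc ‖α‖ * ‖u (k + 1)‖ ≤ ‖α‖ * (‖α‖ * ‖u k‖ + ‖α‖ ^ k * ‖u 1 - α * u 0‖) := by gcongr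
      _ ≤ ‖α‖ * (‖α‖ ^ k * (‖α‖ * ‖u 0‖ + k * ‖u 1 - α * u 0‖) + ‖α‖ ^ k * ‖u 1 - α * u 0‖) := by
          refine mul_le_mul_of_nonneg_left ?_ (norm_nonneg _)
          linarith [ih (by omega)]
      _ = _ := by push_cast; ring

/-- The roots of the characteristic polynomial of the chain in the left tree. They are complex with
product `2` in the band `x ^ 2 ≤ 8 / 9`, and real outside of it. -/
theorem exists_char_root {x : ℝ} (hx : |x| ≤ 1) :
    ∃ ζ : ℂ, ζ ^ 2 - 3 * x * ζ + 2 = 0 ∧ 2 ≤ ‖ζ‖ ^ 2 ∧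
      ‖ζ‖ ^ 2 ≤ if x ^ 2 ≤ 8 / 9 then 2 else 4 := by
  by_cases h : x ^ 2 ≤ 8 / 9
  · have hD : 0 ≤ 8 - 9 * x ^ 2 := by linarith
    have hs := Real.sq_sqrt hD
    have hs' : ((√(8 - 9 * x ^ 2) : ℝ) : ℂ) ^ 2 = 8 - 9 * (x : ℂ) ^ 2 := by
      rw [← Complex.ofReal_pow, hs]; push_cast; ring
    have hn : ‖(⟨3 * x / 2, √(8 - 9 * x ^ 2) / 2⟩ : ℂ)‖ ^ 2 = 2 := by
      rw [← Complex.normSq_eq_norm_sq, Complex.normSq_mk]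
      linear_combination (1 / 4 : ℝ) * hs
    refine ⟨⟨3 * x / 2, √(8 - 9 * x ^ 2) / 2⟩, ?_, hn.ge, ?_⟩
    · rw [Complex.mk_eq_add_mul_I]
      push_cast
      linear_combination (1 / 4 : ℂ) * (Complex.I ^ 2) * hs' +
        (2 - 9 / 4 * (x : ℂ) ^ 2) * Complex.I_sq
    · rw [if_pos h]; exact hn.le
  · rw [not_le] at h
    have hD : 0 ≤ 9 * x ^ 2 - 8 := by linarith
    have hs := Real.sq_sqrt hD
    have hx1 : x ^ 2 ≤ 1 := by rw [← sq_abs]; nlinarith [abs_nonneg x]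
    have hs0 := Real.sqrt_nonneg (9 * x ^ 2 - 8)
    have hs1 : √(9 * x ^ 2 - 8) ≤ 1 := Real.sqrt_le_one.2 (by linarith)
    set s := √(9 * x ^ 2 - 8)
    -- the root of the larger absolute value has the sign of `x`
    have main : ∀ σ : ℝ, σ ^ 2 = 1 → 0 ≤ σ * x → ∃ ζ : ℂ, ζ ^ 2 - 3 * x * ζ + 2 = 0 ∧
        2 ≤ ‖ζ‖ ^ 2 ∧ ‖ζ‖ ^ 2 ≤ 4 := by
      intro σ hσ hσx
      refine ⟨(((3 * x + σ * s) / 2 : ℝ) : ℂ), ?_, ?_, ?_⟩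
      · have : ((3 * x + σ * s) / 2) ^ 2 - 3 * x * ((3 * x + σ * s) / 2) + 2 = 0 := by
          linear_combination (1 / 4 : ℝ) * hs + (1 / 4 : ℝ) * s ^ 2 * hσ
        exact_mod_cast congrArg (fun r : ℝ => (r : ℂ)) this
      · rw [Complex.norm_real, Real.norm_eq_abs, sq_abs]
        nlinarith [mul_nonneg hσx hs0, sq_nonneg (σ * s)]
      · rw [Complex.norm_real, Real.norm_eq_abs, sq_abs]
        have hle : σ * x * s ≤ 1 := by
          have h1 : σ * x ≤ 1 := by
            have : (σ * x) ^ 2 ≤ 1 := by rw [mul_pow, hσ]; linarith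
            nlinarith
          nlinarith
        have : ((3 * x + σ * s) / 2) ^ 2 = (9 * x ^ 2 + 6 * (σ * x * s) + s ^ 2) / 4 := by
          linear_combination (1 / 4 : ℝ) * s ^ 2 * hσ
        rw [this]
        nlinarith
    rw [if_neg (not_le.2 h)]
    rcases le_total 0 x with h0 | h0
    · exact main 1 (by norm_num) (by linarith)
    · exact main (-1) (by norm_num) (by linarith)

/-- The last arrival polynomial is small in the band, and grows at most like `2 ^ n` outside. -/
theorem abs_eval_arrivalPoly_le {n : ℕ} (hn : 1 ≤ n) {x : ℝ} (hx : |x| ≤ 1) :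
    |(arrivalPoly n (2 * n + 1)).eval x| ≤ 234 * n ^ 2 * (if x ^ 2 ≤ 8 / 9 then 1 else 2) ^ n := by
  obtain ⟨ζ, hζ, hlo, hhi⟩ := exists_char_root hx
  set r : ℕ → ℂ := fun j => (((arrivalPoly n j).eval x : ℝ) : ℂ) with hr
  have hxn : ‖(x : ℂ)‖ ≤ 1 := by rwa [Complex.norm_real, Real.norm_eq_abs]
  have hr0 : r 0 = 1 := by simp [hr, arrivalPoly]
  have hr1 : r 1 = (stepDown n 1 : ℂ)⁻¹ * x := by simp [hr, arrivalPoly]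
  have hr2 : ∀ j, r (j + 2) = (stepDown n (j + 2) : ℂ)⁻¹ * (x * r (j + 1) - stepUp n j * r j) := by
    intro j; simp [hr, arrivalPoly]
  have hd1 : stepDown n 1 = 1 / 3 := by simp [stepDown, hn]
  have hζ0 : ζ ≠ 0 := by rintro rfl; norm_num at hlo
  have hζ1 : 1 ≤ ‖ζ‖ := by nlinarith [norm_nonneg ζ]
  have hζ2 : ‖ζ‖ ≤ 2 := by
    have : ‖ζ‖ ^ 2 ≤ 4 := hhi.trans (by split_ifs <;> norm_num)
    nlinarith [norm_nonneg ζ]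
  have hζ2' : ‖(2 : ℂ) / ζ‖ ≤ ‖ζ‖ := by
    rw [norm_div, div_le_iff₀ (by linarith)]
    have : ‖(2 : ℂ)‖ = 2 := by norm_num
    rw [this]; nlinarith
  have hsum : ζ + 2 / ζ = 3 * x := by
    field_simp
    linear_combination hζ
  -- the left tree; the root has only two neighbours, which amounts to the initial value `3 / 2`
  set u : ℕ → ℂ := fun k => if k = 0 then 3 / 2 else r k with hu
  have hu0 : u 0 = 3 / 2 := if_pos rfl
  have hus : ∀ k, u (k + 1) = r (k + 1) := fun k => if_neg (Nat.succ_ne_zero k)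
  have hurec : ∀ k, k + 2 ≤ n → u (k + 2) = (ζ + 2 / ζ) * u (k + 1) - ζ * (2 / ζ) * u k := by
    intro k hk
    have e1 : stepDown n (k + 2) = 1 / 3 := by simp [stepDown, hk]
    rw [hsum, mul_div_cancel₀ _ hζ0, hus, hus, hr2, e1]
    rcases Nat.eq_zero_or_pos k with rfl | h0
    · rw [hu0, hr0]; simp [stepUp]; ring
    · obtain ⟨k, rfl⟩ : ∃ i, k = i + 1 := ⟨k - 1, by omega⟩
      have e2 : stepUp n (k + 1) = 2 / 3 := by simp [stepUp, show k + 1 ≤ n by omega]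
      rw [hus, e2]; push_cast; ring
  set M : ℝ := ‖ζ‖ ^ n * (6 * n + 3) with hM
  have hM0 : 0 ≤ M := by positivity
  have hub : ∀ k ≤ n, ‖u k‖ ≤ M := by
    intro k hk
    have h := norm_le_of_linear_recurrence hζ2' hurec hk
    have hv0 : ‖u 1 - ζ * u 0‖ ≤ 6 := by
      rw [hu0, hus, hr1, hd1]
      calc ‖((1 / 3 : ℝ) : ℂ)⁻¹ * x - ζ * (3 / 2)‖ ≤ 3 * ‖(x : ℂ)‖ + ‖ζ‖ * (3 / 2) := by
            refine (norm_sub_le _ _).trans (le_of_eq ?_)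
            rw [norm_mul, norm_mul]; norm_num
        _ ≤ 6 := by linarith
    have hu0' : ‖u 0‖ = 3 / 2 := by rw [hu0]; norm_num
    have hk' : (k : ℝ) ≤ n := by exact_mod_cast hk
    calc ‖u k‖ ≤ ‖ζ‖ * ‖u k‖ := le_mul_of_one_le_left (norm_nonneg _) hζ1
      _ ≤ ‖ζ‖ ^ k * (‖ζ‖ * ‖u 0‖ + k * ‖u 1 - ζ * u 0‖) := h
      _ ≤ ‖ζ‖ ^ n * (2 * (3 / 2) + n * 6) := by
          rw [hu0']
          gcongr
      _ = M := by rw [hM]; ring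
  -- the right tree
  set w : ℕ → ℂ := fun k => if k = 0 then 2 * r n else r (n + k) with hw
  have hw0 : w 0 = 2 * r n := if_pos rfl
  have hws : ∀ k, w (k + 1) = r (n + (k + 1)) := fun k => if_neg (Nat.succ_ne_zero k)
  have hrn : r n = u n := (if_neg (by omega)).symm
  have hw1 : w 1 = 3 / 2 * x * u n - u (n - 1) := by
    obtain ⟨m, rfl⟩ : ∃ m, n = m + 1 := ⟨n - 1, by omega⟩
    have e1 : stepDown (m + 1) (m + 2) = 2 / 3 := by
      unfold stepDown
      rw [if_neg (by omega), if_neg (by omega), if_pos (by omega)]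
    rw [hws 0, show m + 1 + (0 + 1) = m + 2 from rfl, hr2, e1, Nat.add_sub_cancel, hus]
    rcases Nat.eq_zero_or_pos m with rfl | h0
    · rw [hu0, hr0]; simp [stepUp]; ring
    · obtain ⟨k, rfl⟩ : ∃ i, m = i + 1 := ⟨m - 1, by omega⟩
      have e2 : stepUp (k + 1 + 1) (k + 1) = 2 / 3 := by simp [stepUp]
      rw [hus, e2]; push_cast; ring
  have hβ : ‖1 / ζ‖ ≤ ‖ζ / 2‖ := by
    rw [norm_div, norm_div, div_le_div_iff₀ (by linarith) (by norm_num)]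
    have h2 : ‖(2 : ℂ)‖ = 2 := by norm_num
    rw [h2, norm_one]; nlinarith
  have hsum' : ζ / 2 + 1 / ζ = 3 / 2 * x := by
    field_simp
    linear_combination hζ
  have hwrec : ∀ k, k + 2 ≤ n →
      w (k + 2) = (ζ / 2 + 1 / ζ) * w (k + 1) - ζ / 2 * (1 / ζ) * w k := by
    intro k hk
    have e1 : stepDown n (n + k + 2) = 2 / 3 := by
      unfold stepDown
      rw [if_neg (by omega), if_neg (by omega), if_pos (by omega)]
    have e3 : ζ / 2 * (1 / ζ) = 1 / 2 := by field_simp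
    rw [hsum', e3, hws, hws, show n + (k + 1 + 1) = n + k + 2 by ring, hr2, e1,
      show n + (k + 1) = n + k + 1 by ring]
    rcases Nat.eq_zero_or_pos k with rfl | h0
    · have e2 : stepUp n (n + 0) = 2 / 3 := by
        unfold stepUp; rw [if_neg (by omega), if_pos (by omega)]
      rw [hw0, e2, Nat.add_zero]; push_cast; ring_nf
    · obtain ⟨k, rfl⟩ : ∃ i, k = i + 1 := ⟨k - 1, by omega⟩
      have e2 : stepUp n (n + (k + 1)) = 1 / 3 := by
        unfold stepUp; rw [if_neg (by omega), if_neg (by omega), if_pos (by omega)]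
      rw [hws, e2]; push_cast; ring
  have hη : ‖ζ / 2‖ = ‖ζ‖ / 2 := by rw [norm_div]; norm_num
  set η : ℝ := ‖ζ‖ / 2 with hηdef
  have hη1 : η ≤ 1 := by linarith
  have hη0 : 0 ≤ η := by positivity
  have hηsq : 1 / 2 ≤ η ^ 2 := by rw [hηdef, div_pow]; linarith
  have hwb : ∀ k ≤ n, η * ‖w k‖ ≤ η ^ k * (M * (2 + 9 / 2 * n)) := by
    intro k hk
    have h := norm_le_of_linear_recurrence hβ hwrec hk
    rw [hη] at h
    have hun := hub n le_rfl
    have hun' := hub (n - 1) (by omega)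
    have hw0' : ‖w 0‖ ≤ 2 * M := by
      rw [hw0, hrn, norm_mul]
      have : ‖(2 : ℂ)‖ = 2 := by norm_num
      rw [this]; linarith
    have hv0 : ‖w 1 - ζ / 2 * w 0‖ ≤ 9 / 2 * M := by
      rw [hw1]
      calc ‖3 / 2 * x * u n - u (n - 1) - ζ / 2 * w 0‖
          ≤ 3 / 2 * ‖(x : ℂ)‖ * ‖u n‖ + ‖u (n - 1)‖ + η * ‖w 0‖ := by
            refine (norm_sub_le _ _).trans (add_le_add ((norm_sub_le _ _).trans (le_of_eq ?_)) ?_)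
            · rw [norm_mul, norm_mul]; norm_num
            · rw [norm_mul, hη]
        _ ≤ 3 / 2 * 1 * M + M + 1 * (2 * M) := by gcongr
        _ = 9 / 2 * M := by ring
    have hk' : (k : ℝ) ≤ n := by exact_mod_cast hk
    calc η * ‖w k‖ ≤ η ^ k * (η * ‖w 0‖ + k * ‖w 1 - ζ / 2 * w 0‖) := h
      _ ≤ η ^ k * (1 * (2 * M) + n * (9 / 2 * M)) := by gcongr
      _ = _ := by ring
  obtain ⟨m, hm⟩ : ∃ m, n = m + 1 := ⟨n - 1, by omega⟩
  have hlast : r (2 * n + 1) = x * w n - 1 / 3 * w (n - 1) := by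
    have e1 : stepDown n (2 * n + 1) = 1 := by
      unfold stepDown
      rw [if_neg (by omega), if_neg (by omega), if_neg (by omega), if_pos rfl]
    have e0 : w n = r (2 * n) := by
      have := hws m
      rw [← hm] at this
      rw [this, two_mul]
    rw [show 2 * n + 1 = (2 * m + 1) + 2 by omega, hr2, show 2 * m + 1 + 2 = 2 * n + 1 by omega,
      e1, e0, show 2 * m + 1 + 1 = 2 * n by omega]
    rcases Nat.eq_zero_or_pos m with rfl | h0
    · subst hm
      rw [Nat.sub_self, hw0]
      simp [stepUp]; ring_nf
    · obtain ⟨k, hk⟩ : ∃ i, m = i + 1 := ⟨m - 1, by omega⟩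
      have e2 : stepUp n (2 * m + 1) = 1 / 3 := by
        unfold stepUp; rw [if_neg (by omega), if_neg (by omega), if_pos (by omega)]
      have e4 : w (n - 1) = r (2 * m + 1) := by
        rw [show n - 1 = k + 1 by omega, hws, show n + (k + 1) = 2 * m + 1 by omega]
      rw [e2, e4]; push_cast; ring
  set B : ℝ := η ^ n * (M * (2 + 9 / 2 * n)) with hB
  have h1 : η ^ 2 * ‖w n‖ ≤ B := by
    calc η ^ 2 * ‖w n‖ ≤ η * ‖w n‖ := by gcongr; nlinarith
      _ ≤ B := hwb n le_rfl
  have h2 : η ^ 2 * ‖w (n - 1)‖ ≤ B := by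
    calc η ^ 2 * ‖w (n - 1)‖ = η * (η * ‖w (n - 1)‖) := by ring
      _ ≤ η * (η ^ (n - 1) * (M * (2 + 9 / 2 * n))) :=
        mul_le_mul_of_nonneg_left (hwb _ (by omega)) hη0
      _ = B := by rw [hB, hm, Nat.add_sub_cancel, pow_succ]; ring
  have h3 : ‖r (2 * n + 1)‖ ≤ ‖w n‖ + ‖w (n - 1)‖ := by
    rw [hlast]
    refine (norm_sub_le _ _).trans (add_le_add ?_ ?_)
    · rw [norm_mul]; exact mul_le_of_le_one_left (norm_nonneg _) hxn
    · rw [norm_mul]; exact mul_le_of_le_one_left (norm_nonneg _) (by norm_num)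
  have h4 : ‖r (2 * n + 1)‖ ≤ 4 * B := by
    have := norm_nonneg (w n)
    have := norm_nonneg (w (n - 1))
    nlinarith
  have hgrow : η ^ n * ‖ζ‖ ^ n ≤ (if x ^ 2 ≤ 8 / 9 then 1 else 2) ^ n := by
    rw [← mul_pow]
    refine pow_le_pow_left₀ (by positivity) ?_ n
    have e : η * ‖ζ‖ = ‖ζ‖ ^ 2 / 2 := by rw [hηdef]; ring
    rw [e]
    split_ifs at hhi ⊢ <;> linarith
  have hn' : (1 : ℝ) ≤ n := by exact_mod_cast hn
  have hfin : 4 * B ≤ 234 * n ^ 2 * (if x ^ 2 ≤ 8 / 9 then 1 else 2) ^ n := by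
    have : 4 * B = (η ^ n * ‖ζ‖ ^ n) * (108 * n ^ 2 + 102 * n + 24) := by
      rw [hB, hM]; ring
    rw [this, mul_comm]
    refine mul_le_mul ?_ hgrow (by positivity) (by positivity)
    have : (n : ℝ) ≤ n ^ 2 := by nlinarith
    linarith
  have h5 : ‖r (2 * n + 1)‖ = |(arrivalPoly n (2 * n + 1)).eval x| := by
    rw [hr, Complex.norm_real, Real.norm_eq_abs]
  rw [← h5]
  exact h4.trans hfin

/-! ### The walk hits the other end with polynomially small amplitude -/

theorem two_pow_succ_le (n : ℕ) : (2 : ℝ) ^ (n + 1) ≤ 2 * 9 ^ n := by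
  rw [pow_succ, mul_comm]
  gcongr
  norm_num

/-- The factor `(1 - X ^ 2) ^ (2 * (n / 2))` compensates the growth of the arrival polynomial
outside the band. -/
theorem abs_eval_dampedArrivalPoly_le {n : ℕ} (hn : 1 ≤ n) {x : ℝ} (hx : |x| ≤ 1) :
    |(arrivalPoly n (2 * n + 1) * (1 - X ^ 2) ^ (2 * (n / 2)) : ℝ[X]).eval x| ≤ 468 * n ^ 2 := by
  have hx2 : x ^ 2 ≤ 1 := by rw [← sq_abs]; nlinarith [abs_nonneg x]
  have h := abs_eval_arrivalPoly_le hn hx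
  simp only [eval_mul, eval_pow, eval_sub, eval_one, eval_X, abs_mul]
  have h0 : 0 ≤ 1 - x ^ 2 := by linarith
  rw [abs_of_nonneg (pow_nonneg h0 _)]
  have hc : (if x ^ 2 ≤ 8 / 9 then (1 : ℝ) else 2) ^ n * (1 - x ^ 2) ^ (2 * (n / 2)) ≤ 2 := by
    split_ifs with hb
    · rw [one_pow, one_mul]
      exact (pow_le_one₀ h0 (by nlinarith)).trans (by norm_num)
    · obtain ⟨m, rfl⟩ : ∃ m, n = m + 1 := ⟨n - 1, by omega⟩
      have h1 : (1 - x ^ 2) ^ (2 * ((m + 1) / 2)) ≤ (1 / 9) ^ m := by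
        calc (1 - x ^ 2) ^ (2 * ((m + 1) / 2)) ≤ (1 - x ^ 2) ^ m :=
              pow_le_pow_of_le_one h0 (by nlinarith) (by omega)
          _ ≤ (1 / 9) ^ m := pow_le_pow_left₀ h0 (by linarith) m
      calc (2 : ℝ) ^ (m + 1) * (1 - x ^ 2) ^ (2 * ((m + 1) / 2))
          ≤ (2 * 9 ^ m) * (1 / 9) ^ m := by
            gcongr
            exact two_pow_succ_le m
        _ = 2 := by rw [mul_assoc, ← mul_pow]; norm_num
  calc |(arrivalPoly n (2 * n + 1)).eval x| * (1 - x ^ 2) ^ (2 * (n / 2))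
      ≤ (234 * n ^ 2 * (if x ^ 2 ≤ 8 / 9 then 1 else 2) ^ n) * (1 - x ^ 2) ^ (2 * (n / 2)) := by
        gcongr
    _ = 234 * n ^ 2 *
        ((if x ^ 2 ≤ 8 / 9 then 1 else 2) ^ n * (1 - x ^ 2) ^ (2 * (n / 2))) := by ring
    _ ≤ 234 * n ^ 2 * 2 := by gcongr
    _ = 468 * n ^ 2 := by ring

/-- A function of the column in the left tree on which the transition operator vanishes, except
close to the leaves. -/
noncomputable def zeroMode (n j : ℕ) : ℝ := if Even j ∧ j ≤ n then (-1 / 2) ^ (j / 2) else 0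

theorem colOp_zeroMode {n j : ℕ} (hj : j + 1 ≤ n) : colOp n (zeroMode n) j = 0 := by
  rw [colOp_apply]
  rcases Nat.even_or_odd j with he | ho
  · have h1 : ¬ Even (j + 1) := by rw [Nat.not_even_iff_odd]; exact he.add_one
    have e1 : zeroMode n (j + 1) = 0 := if_neg fun h => h1 h.1
    rcases Nat.eq_zero_or_pos j with rfl | h0
    · rw [e1, show stepDown n 0 = 0 from if_pos rfl]; ring
    · have h2 : ¬ Even (j - 1) := by
        rw [Nat.not_even_iff_odd]; exact Nat.Even.sub_odd h0 he odd_one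
      have e2 : zeroMode n (j - 1) = 0 := if_neg fun h => h2 h.1
      rw [e1, e2]; ring
  · obtain ⟨i, rfl⟩ := ho
    have e1 : zeroMode n (2 * i + 1 - 1) = (-1 / 2) ^ i := by
      rw [zeroMode, if_pos ⟨by simp, by omega⟩]; congr 1; omega
    have e2 : zeroMode n (2 * i + 1 + 1) = (-1 / 2) ^ (i + 1) := by
      rw [zeroMode, if_pos ⟨⟨i + 1, by ring⟩, by omega⟩]; congr 1; omega
    have e3 : stepDown n (2 * i + 1) = 1 / 3 := by
      unfold stepDown; rw [if_neg (by omega), if_pos (by omega)]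
    have e4 : stepUp n (2 * i + 1) = 2 / 3 := by
      unfold stepUp; rw [if_neg (by omega), if_pos (by omega)]
    rw [e1, e2, e3, e4, pow_succ]; ring

theorem aeval_one_sub_sq_zeroMode {n m : ℕ} (hm : 2 * m ≤ n) :
    aeval (colOp n) ((1 - X ^ 2 : ℝ[X]) ^ m) (zeroMode n) 0 = 1 := by
  have key : ∀ i ≤ m, aeval (colOp n) ((1 - X ^ 2 : ℝ[X]) ^ i) (zeroMode n) 0 = 1 ∧
      ∀ j, j + 1 + 2 * i ≤ n →
        colOp n (aeval (colOp n) ((1 - X ^ 2 : ℝ[X]) ^ i) (zeroMode n)) j = 0 := by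
    intro i
    induction i with
    | zero =>
      intro _
      refine ⟨by simp [zeroMode], fun j hj => ?_⟩
      rw [pow_zero, map_one]
      exact colOp_zeroMode (by omega)
    | succ i ih =>
      intro hi
      obtain ⟨h1, h2⟩ := ih (by omega)
      set F := aeval (colOp n) ((1 - X ^ 2 : ℝ[X]) ^ i) (zeroMode n)
      have e : aeval (colOp n) ((1 - X ^ 2 : ℝ[X]) ^ (i + 1)) (zeroMode n) =
          F - colOp n (colOp n F) := by
        rw [pow_succ', map_mul, Module.End.mul_apply]
        simp [pow_two, F]
      have hz : ∀ j, j + 2 + 2 * i ≤ n → colOp n (colOp n F) j = 0 := by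
        intro j hj
        rw [colOp_apply, h2 (j + 1) (by omega)]
        rcases Nat.eq_zero_or_pos j with rfl | h0
        · rw [show stepDown n 0 = 0 from if_pos rfl]; ring
        · rw [h2 (j - 1) (by omega)]; ring
      refine ⟨?_, fun j hj => ?_⟩
      · rw [e, Pi.sub_apply, h1, hz 0 (by omega), sub_zero]
      · rw [e, map_sub, Pi.sub_apply, h2 j (by omega), colOp_apply, hz (j + 1) (by omega)]
        rcases Nat.eq_zero_or_pos j with rfl | h0
        · rw [show stepDown n 0 = 0 from if_pos rfl]; ring
        · rw [hz (j - 1) (by omega)]; ring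
  exact (key m le_rfl).1

theorem colInner_zeroMode_le {n : ℕ} :
    colInner n (zeroMode n) (zeroMode n) ≤ 3 * (n + 1) := by
  have h : ∀ j ∈ Finset.range (2 * n + 2),
      colWeight n j * (zeroMode n j * zeroMode n j) ≤ if j ≤ n then 3 else 0 := by
    intro j _
    by_cases hj : Even j ∧ j ≤ n
    · have e : zeroMode n j * zeroMode n j = (1 / 2) ^ j := by
        obtain ⟨i, hi⟩ := hj.1
        rw [zeroMode, if_pos hj, ← mul_pow, show j / 2 = i by omega, hi, ← two_mul, pow_mul]
        norm_num
      rw [e, if_pos hj.2]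
      unfold colWeight
      rw [if_pos hj.2]
      split_ifs with h0
      · subst h0; norm_num
      · rw [mul_assoc, ← mul_pow]; norm_num
    · rw [zeroMode, if_neg hj]
      split_ifs <;> norm_num
  refine (Finset.sum_le_sum h).trans ?_
  rw [← Finset.sum_filter, Finset.sum_const, nsmul_eq_mul, mul_comm]
  gcongr
  have : (Finset.range (2 * n + 2)).filter (· ≤ n) ⊆ Finset.range (n + 1) := by
    intro j hj
    simp only [Finset.mem_filter, Finset.mem_range] at hj ⊢
    omega
  have := Finset.card_le_card this
  rw [Finset.card_range] at this
  exact_mod_cast this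

/-- By Cauchy-Schwarz with the zero mode, the walk has a large return amplitude at energies close
to `0`. -/
theorem return_amplitude_ge {n : ℕ} (hn : 1 ≤ n) :
    2 / (3 * (n + 1) : ℝ) ≤
      aeval (colOp n) ((1 - X ^ 2 : ℝ[X]) ^ (2 * (n / 2))) (Pi.single 0 1) 0 := by
  set p : ℝ[X] := (1 - X ^ 2) ^ (n / 2) with hp
  set δ : ℕ → ℝ := Pi.single 0 1 with hδ
  have hsingle : ∀ F : ℕ → ℝ, colInner n δ F = 2 * F 0 := by
    intro F
    rw [colInner, Finset.sum_eq_single 0]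
    · simp [hδ, colWeight]
    · intro j _ hj
      simp [hδ, Pi.single_eq_of_ne hj]
    · intro h; exact absurd (Finset.mem_range.2 (by omega)) h
  have h1 : colInner n (aeval (colOp n) p δ) (aeval (colOp n) p δ) =
      2 * aeval (colOp n) ((1 - X ^ 2 : ℝ[X]) ^ (2 * (n / 2))) δ 0 := by
    rw [colInner_aeval hn, hsingle, ← Module.End.mul_apply, ← map_mul, hp, ← pow_add,
      two_mul (n / 2)]
  have h2 : colInner n (aeval (colOp n) p δ) (zeroMode n) = 2 := by
    rw [colInner_aeval hn, hsingle, aeval_one_sub_sq_zeroMode (by omega), mul_one]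
  have h3 := colInner_sq_le n (aeval (colOp n) p δ) (zeroMode n)
  rw [h1, h2] at h3
  set v := aeval (colOp n) ((1 - X ^ 2 : ℝ[X]) ^ (2 * (n / 2))) δ 0
  have h4 := colInner_zeroMode_le (n := n)
  have h5 := colInner_self_nonneg n (zeroMode n)
  have hv : 0 ≤ v := by
    have := colInner_self_nonneg n (aeval (colOp n) p δ)
    rw [h1] at this; linarith
  rw [div_le_iff₀ (by positivity)]
  nlinarith

/-- The amplitude at `target` of `T_t(P)` applied to `source`. -/
noncomputable def hitAmplitude (n t : ℕ) : ℝ :=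
  aeval (colOp n) (Chebyshev.T ℝ t) (Pi.single 0 1) (2 * n + 1)

theorem exists_hitAmplitude_ge {n : ℕ} (hn : 1 ≤ n) :
    ∃ t, 1 ≤ t ∧ t ≤ 4 * n + 1 ∧ 1 / (16848 * n ^ 4 : ℝ) ≤ |hitAmplitude n t| := by
  set h : ℝ[X] := (1 - X ^ 2) ^ (2 * (n / 2)) with hh
  let Λ : ℝ[X] →ₗ[ℝ] ℝ :=
    { toFun := fun q => aeval (colOp n) q (Pi.single 0 1) (2 * n + 1)
      map_add' := fun p q => by simp
      map_smul' := fun c q => by simp }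
  have hdeg : (arrivalPoly n (2 * n + 1) * h).natDegree ≤ 4 * n + 1 := by
    have h1 := arrivalPoly_natDegree_le n (2 * n + 1)
    have h2 : h.natDegree ≤ 2 * (n / 2) * 2 := by
      refine natDegree_pow_le.trans (Nat.mul_le_mul_left _ ?_)
      refine (natDegree_sub_le _ _).trans ?_
      simp
    have := natDegree_mul_le (p := arrivalPoly n (2 * n + 1)) (q := h)
    omega
  -- by the reflection symmetry, arrival at `target` amounts to a return to `source`
  have hΛ : Λ (arrivalPoly n (2 * n + 1) * h) = aeval (colOp n) h (Pi.single 0 1) 0 := by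
    show aeval (colOp n) (arrivalPoly n (2 * n + 1) * h) (Pi.single 0 1) (2 * n + 1) = _
    rw [mul_comm, map_mul, Module.End.mul_apply, aeval_arrivalPoly le_rfl,
      aeval_colOp_reflect (H := Pi.single 0 1) h (fun j hj => ?_) le_rfl, Nat.sub_self]
    rcases Nat.lt_or_ge j (2 * n + 1) with hlt | hge
    · rw [Pi.single_eq_of_ne hlt.ne, Pi.single_eq_of_ne (by omega)]
    · obtain rfl : j = 2 * n + 1 := by omega
      simp
  obtain ⟨t, ht, hle⟩ := exists_chebyshev_large Λ (4 * n + 1) _ hdeg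
    (fun x hx => abs_eval_dampedArrivalPoly_le hn hx)
  have hret := return_amplitude_ge hn
  rw [← hh, ← hΛ] at hret
  have hchain := hret.trans ((le_abs_self _).trans hle)
  change _ ≤ _ * |hitAmplitude n t| at hchain
  have hn' : (1 : ℝ) ≤ n := by exact_mod_cast hn
  have hpos : (0 : ℝ) < 2 / (3 * (n + 1)) := by positivity
  refine ⟨t, ?_, ht, ?_⟩
  · rw [Nat.one_le_iff_ne_zero]
    rintro rfl
    have : hitAmplitude n 0 = 0 := by simp [hitAmplitude]
    rw [this, abs_zero, mul_zero] at hchain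
    linarith
  · have ha := abs_nonneg (hitAmplitude n t)
    have h1 : 1 / (3 * n : ℝ) ≤ 2 / (3 * (n + 1)) := by
      rw [div_le_div_iff₀ (by positivity) (by positivity)]; linarith
    have h2 : 2 * (468 * (n : ℝ) ^ 2) * ((4 * n + 1 : ℕ) + 1) ≤ 5616 * n ^ 3 := by
      push_cast
      nlinarith [sq_nonneg (n : ℝ)]
    have h3 : 1 / (3 * n : ℝ) ≤ 5616 * n ^ 3 * |hitAmplitude n t| :=
      (h1.trans hchain).trans (mul_le_mul_of_nonneg_right h2 ha)
    rw [div_le_iff₀ (by positivity)] at h3 ⊢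
    nlinarith

/-! ### The walk of a single particle on the ports of a network -/

section Walk

variable {V : Type} [Fintype V] {G : SimpleGraph V} [DecidableRel G.Adj]

/-- The places where the walker can be: at a node `v`, either at one of its ports, or in the
local memory of `v` (`none`). -/
abbrev Site (G : SimpleGraph V) [DecidableRel G.Adj] : Type := (v : V) × Option (Fin (G.degree v))

/-- Sending the message that carries the walker moves it across the edge of its port; the walker
in the memory of a node stays there. -/
def siteFlip (N : Network G) : Site G → Site G
  | ⟨v, none⟩ => ⟨v, none⟩
  | ⟨v, some i⟩ => ⟨N.port v i, some (N.backPort v i)⟩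

theorem backPort_eq_of_port_eq (N : Network G) {u v : V} {i : Fin (G.degree u)}
    {j : Fin (G.degree v)} (hi : (N.port u i : V) = v) (hj : (N.port v j : V) = u) :
    (⟨N.port u i, some (N.backPort u i)⟩ : Site G) = ⟨v, some j⟩ := by
  have hadj : v ∈ G.neighborSet u := hi ▸ (N.port u i).2
  have key : ∀ x : G.neighborSet u, (x : V) = v →
      (⟨x, some ((N.port (x : V)).symm ⟨u, G.adj_symm x.2⟩)⟩ : Site G) = ⟨v, some j⟩ := by
    rintro ⟨x, hx⟩ rfl
    have : (N.port x).symm ⟨u, G.adj_symm hx⟩ = j := by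
      rw [Equiv.symm_apply_eq]; exact Subtype.ext hj.symm
    simp only [this]
  exact key (N.port u i) hi

theorem port_backPort (N : Network G) (u : V) (i : Fin (G.degree u)) :
    (N.port (N.port u i) (N.backPort u i) : V) = u := by
  rw [Network.backPort, Equiv.apply_symm_apply]

theorem siteFlip_siteFlip (N : Network G) (s : Site G) : siteFlip N (siteFlip N s) = s := by
  obtain ⟨v, _ | i⟩ := s
  · rfl
  · exact backPort_eq_of_port_eq N (port_backPort N v i) rfl

/-- Moving the walker across the edges, on amplitudes. -/
def flipOp (N : Network G) : Module.End ℝ (Site G → ℝ) := LinearMap.funLeft ℝ ℝ (siteFlip N)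

theorem flipOp_apply (N : Network G) (α : Site G → ℝ) (s : Site G) :
    flipOp N α s = α (siteFlip N s) := rfl

theorem flipOp_mul_self (N : Network G) : flipOp N * flipOp N = 1 := by
  refine LinearMap.ext fun α => funext fun s => ?_
  show α (siteFlip N (siteFlip N s)) = α s
  rw [siteFlip_siteFlip]

theorem flipOp_dotProduct (N : Network G) (α β : Site G → ℝ) :
    flipOp N α ⬝ᵥ β = α ⬝ᵥ flipOp N β := by
  refine Fintype.sum_equiv ⟨siteFlip N, siteFlip N, siteFlip_siteFlip N, siteFlip_siteFlip N⟩
    _ _ fun s => ?_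
  simp [flipOp_apply, siteFlip_siteFlip]

/-- The transition operator of the simple random walk on the graph. -/
noncomputable def avgOp (N : Network G) : Module.End ℝ (V → ℝ) where
  toFun h v := (∑ i, h (N.port v i)) / G.degree v
  map_add' h k := by ext v; simp only [Pi.add_apply, Finset.sum_add_distrib, add_div]
  map_smul' a h := by
    ext v; simp only [Pi.smul_apply, smul_eq_mul, ← Finset.mul_sum, RingHom.id_apply, mul_div_assoc]

theorem avgOp_apply (N : Network G) (h : V → ℝ) (v : V) :
    avgOp N h v = (∑ i, h (N.port v i)) / G.degree v := rfl

/-- The vector with coefficient `c.1` at the memory of a node of degree `d` and `c.2` at the uniform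
superposition of its ports. It is `0` if there are no ports. -/
noncomputable def slotVec (c : ℝ × ℝ) (d : ℕ) : Option (Fin d) → ℝ
  | none => if d = 0 then 0 else c.1
  | some _ => c.2 / √d

theorem sum_slotVec_sq (c : ℝ × ℝ) {d : ℕ} (hd : d ≠ 0) (hc : c.1 ^ 2 + c.2 ^ 2 = 1) :
    ∑ o, slotVec c d o * slotVec c d o = 1 := by
  have hd' : (0 : ℝ) < d := by exact_mod_cast Nat.pos_of_ne_zero hd
  have h := Real.mul_self_sqrt hd'.le
  have h0 := (Real.sqrt_pos.2 hd').ne'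
  rw [Fintype.sum_option]
  simp only [slotVec, if_neg hd, Finset.sum_const, Finset.card_univ, Fintype.card_fin, nsmul_eq_mul]
  rw [← hc, div_mul_div_comm, h]
  field_simp

/-- A choice, for every role, of a reflection: its coefficients are normalised, or both zero. -/
def IsReflectionData (c : Role → ℝ × ℝ) : Prop :=
  ∀ ρ, (c ρ).1 ^ 2 + (c ρ).2 ^ 2 = 1 ∨ c ρ = 0

theorem sum_slotVec_sq_mul {c : Role → ℝ × ℝ} (hc : IsReflectionData c) (ρ : Role) {d : ℕ}
    (o : Option (Fin d)) :
    (∑ o', slotVec (c ρ) d o' * slotVec (c ρ) d o') * slotVec (c ρ) d o = slotVec (c ρ) d o := by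
  by_cases hd : d = 0
  · subst hd
    have : slotVec (c ρ) 0 o = 0 := by rcases o with _ | i; exacts [by simp [slotVec], i.elim0]
    rw [this, mul_zero]
  · rcases hc ρ with h | h
    · rw [sum_slotVec_sq _ hd h, one_mul]
    · have : slotVec (c ρ) d o = 0 := by rw [h]; rcases o with _ | i <;> simp [slotVec]
      rw [this, mul_zero]

variable [DecidableEq V]

/-- The vectors `slotVec` at all nodes, with the coefficients determined by the roles. -/
noncomputable def siteVec (N : Network G) (c : Role → ℝ × ℝ) (s : Site G) : ℝ :=
  slotVec (c (N.role s.1)) (G.degree s.1) s.2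

/-- Every node reflects its part of the state about the hyperplane orthogonal to its vector. -/
noncomputable def reflectOp (N : Network G) (c : Role → ℝ × ℝ) : Module.End ℝ (Site G → ℝ) where
  toFun α s := α s - 2 * siteVec N c s * ∑ o, siteVec N c ⟨s.1, o⟩ * α ⟨s.1, o⟩
  map_add' α β := by
    ext s; simp only [Pi.add_apply, mul_add, Finset.sum_add_distrib]; ring
  map_smul' a α := by
    ext s
    simp only [Pi.smul_apply, smul_eq_mul, RingHom.id_apply, mul_left_comm _ a, ← Finset.mul_sum]
    ring

theorem reflectOp_apply (N : Network G) (c : Role → ℝ × ℝ) (α : Site G → ℝ) (s : Site G) :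
    reflectOp N c α s =
      α s - 2 * siteVec N c s * ∑ o, siteVec N c ⟨s.1, o⟩ * α ⟨s.1, o⟩ := rfl

theorem reflectOp_mul_self (N : Network G) {c : Role → ℝ × ℝ} (hc : IsReflectionData c) :
    reflectOp N c * reflectOp N c = 1 := by
  refine LinearMap.ext fun α => funext fun s => ?_
  obtain ⟨v, o⟩ := s
  show reflectOp N c (reflectOp N c α) ⟨v, o⟩ = α ⟨v, o⟩
  rw [reflectOp_apply]
  simp only [reflectOp_apply N c α]
  set I := ∑ o, siteVec N c ⟨v, o⟩ * α ⟨v, o⟩ with hI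
  have h1 : ∑ o, siteVec N c ⟨v, o⟩ * (α ⟨v, o⟩ - 2 * siteVec N c ⟨v, o⟩ * I) =
      I - 2 * (∑ o, siteVec N c ⟨v, o⟩ * siteVec N c ⟨v, o⟩) * I := by
    rw [hI, mul_assoc, Finset.sum_mul, Finset.mul_sum, ← Finset.sum_sub_distrib]
    exact Finset.sum_congr rfl fun o _ => by ring
  have h2 : (∑ o', siteVec N c ⟨v, o'⟩ * siteVec N c ⟨v, o'⟩) * siteVec N c ⟨v, o⟩ =
      siteVec N c ⟨v, o⟩ := sum_slotVec_sq_mul hc (N.role v) o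
  rw [h1]
  linear_combination (4 * I) * h2

theorem reflectOp_dotProduct (N : Network G) (c : Role → ℝ × ℝ) (α β : Site G → ℝ) :
    reflectOp N c α ⬝ᵥ β = α ⬝ᵥ reflectOp N c β := by
  have key : ∀ α β : Site G → ℝ, reflectOp N c α ⬝ᵥ β = α ⬝ᵥ β - 2 * ∑ v,
      (∑ o, siteVec N c ⟨v, o⟩ * α ⟨v, o⟩) * (∑ o, siteVec N c ⟨v, o⟩ * β ⟨v, o⟩) := by
    intro α β
    simp only [dotProduct, Fintype.sum_sigma]
    rw [Finset.mul_sum, ← Finset.sum_sub_distrib]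
    refine Finset.sum_congr rfl fun v _ => ?_
    rw [Finset.mul_sum, Finset.mul_sum, ← Finset.sum_sub_distrib]
    refine Finset.sum_congr rfl fun o _ => ?_
    rw [reflectOp_apply]; ring
  rw [key, dotProduct_comm α (reflectOp N c β), key, dotProduct_comm β]
  congr 2
  exact Finset.sum_congr rfl fun v _ => mul_comm _ _

/-- A reflection that acts at a single node is a reflection of the whole space. -/
theorem reflectOp_eq_of_single (N : Network G) {c : Role → ℝ × ℝ} {v : V}
    (hc : ∀ w, w ≠ v → c (N.role w) = 0) (α : Site G → ℝ) :
    reflectOp N c α = α - (2 * (siteVec N c ⬝ᵥ α)) • siteVec N c := by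
  have h0 : ∀ w, w ≠ v → ∀ o, siteVec N c ⟨w, o⟩ = 0 := by
    intro w hw o
    show slotVec (c (N.role w)) _ o = 0
    rw [hc w hw]
    rcases o with _ | i <;> simp [slotVec]
  have hdot : siteVec N c ⬝ᵥ α = ∑ o, siteVec N c ⟨v, o⟩ * α ⟨v, o⟩ := by
    simp only [dotProduct, Fintype.sum_sigma]
    refine Fintype.sum_eq_single v fun w hw => ?_
    exact Finset.sum_eq_zero fun o _ => by rw [h0 w hw, zero_mul]
  ext ⟨w, o⟩
  rw [reflectOp_apply, Pi.sub_apply, Pi.smul_apply, smul_eq_mul]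
  by_cases hw : w = v
  · subst hw; rw [hdot]; ring
  · rw [h0 w hw]; ring

/-- The coin of the walk: all nodes reflect about the uniform superposition of their ports. -/
def coinData : Role → ℝ × ℝ := fun _ => (0, 1)

/-- A reflection that is applied by `source` only. -/
def sourceData (a b : ℝ) : Role → ℝ × ℝ
  | .source => (a, b)
  | _ => 0

/-- A reflection that is applied by `target` only. -/
def targetData (a b : ℝ) : Role → ℝ × ℝ
  | .target => (a, b)
  | _ => 0

theorem isReflectionData_coinData : IsReflectionData coinData := fun _ => by simp [coinData]

theorem isReflectionData_sourceData {a b : ℝ} (h : a ^ 2 + b ^ 2 = 1) :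
    IsReflectionData (sourceData a b) := by
  rintro (_ | _ | _)
  exacts [Or.inl h, Or.inr rfl, Or.inr rfl]

theorem isReflectionData_targetData {a b : ℝ} (h : a ^ 2 + b ^ 2 = 1) :
    IsReflectionData (targetData a b) := by
  rintro (_ | _ | _)
  exacts [Or.inr rfl, Or.inl h, Or.inr rfl]

theorem role_source (N : Network G) : N.role N.source = Role.source := if_pos rfl

theorem role_target (N : Network G) (h : N.source ≠ N.target) :
    N.role N.target = Role.target := by
  rw [Network.role, if_neg h.symm, if_pos rfl]

theorem sourceData_role_of_ne (N : Network G) (a b : ℝ) {w : V} (hw : w ≠ N.source) :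
    sourceData a b (N.role w) = 0 := by
  rw [Network.role, if_neg hw]; split_ifs <;> rfl

theorem targetData_role_of_ne (N : Network G) (a b : ℝ) {w : V} (hw : w ≠ N.target) :
    targetData a b (N.role w) = 0 := by
  rw [Network.role, if_neg hw]; split_ifs <;> rfl

/-- The state with the walker in the memory of `v`. -/
def memVec (v : V) : Site G → ℝ := Pi.single ⟨v, none⟩ 1

/-- The state with the walker in the uniform superposition of the ports of `v`. -/
noncomputable def portVec (v : V) : Site G → ℝ
  | ⟨_, none⟩ => 0
  | ⟨w, some _⟩ => if w = v then 1 / √(G.degree w) else 0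

theorem siteVec_single (N : Network G) {c : Role → ℝ × ℝ} {v : V} (hv : G.degree v ≠ 0)
    (hc : ∀ w, w ≠ v → c (N.role w) = 0) :
    siteVec N c = (c (N.role v)).1 • memVec v + (c (N.role v)).2 • portVec v := by
  ext ⟨w, o⟩
  simp only [siteVec, Pi.add_apply, Pi.smul_apply, smul_eq_mul]
  by_cases hw : w = v
  · subst hw
    rcases o with _ | i
    · simp [slotVec, memVec, portVec, hv]
    · simp [slotVec, memVec, portVec, div_eq_mul_inv]
  · rw [hc w hw]
    rcases o with _ | i
    · simp [slotVec, memVec, portVec, hw]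
    · simp [slotVec, memVec, portVec, hw]

theorem memVec_some (v w : V) (i : Fin (G.degree w)) : memVec v ⟨w, some i⟩ = 0 :=
  Pi.single_eq_of_ne (fun h => by simpa using congrArg (fun s : Site G => s.2.isSome) h) _

theorem memVec_dotProduct_self (v : V) : (memVec v : Site G → ℝ) ⬝ᵥ memVec v = 1 := by
  simp [memVec]

theorem memVec_dotProduct_portVec (v w : V) : (memVec v : Site G → ℝ) ⬝ᵥ portVec w = 0 := by
  simp [memVec, portVec]

theorem portVec_dotProduct (v : V) (α : Site G → ℝ) :
    portVec v ⬝ᵥ α = 1 / √(G.degree v) * ∑ i, α ⟨v, some i⟩ := by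
  simp only [dotProduct, Fintype.sum_sigma, Fintype.sum_option, portVec, zero_mul, zero_add]
  rw [Fintype.sum_eq_single v (fun w hw =>
    Finset.sum_eq_zero fun i _ => by rw [if_neg hw, zero_mul]),
    Finset.mul_sum]
  exact Finset.sum_congr rfl fun i _ => by rw [if_pos rfl]

theorem portVec_dotProduct_self {v : V} (hv : G.degree v ≠ 0) :
    (portVec v : Site G → ℝ) ⬝ᵥ portVec v = 1 := by
  have hd : (0 : ℝ) < G.degree v := by exact_mod_cast Nat.pos_of_ne_zero hv
  have h := Real.mul_self_sqrt hd.le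
  have h0 := (Real.sqrt_pos.2 hd).ne'
  rw [portVec_dotProduct]
  simp only [portVec, if_true, Finset.sum_const, Finset.card_univ, Fintype.card_fin, nsmul_eq_mul]
  field_simp
  rw [sq, h]

theorem flipOp_memVec (N : Network G) (v : V) : flipOp N (memVec v) = memVec v := by
  ext ⟨w, o⟩
  rcases o with _ | i
  · rfl
  · rw [flipOp_apply, siteFlip, memVec_some, memVec_some]

theorem coin_memVec (N : Network G) (v : V) : reflectOp N coinData (memVec v) = memVec v := by
  have h : ∀ w, siteVec N coinData ⟨w, none⟩ = 0 := fun w => by simp [siteVec, slotVec, coinData]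
  ext ⟨w, o⟩
  rw [reflectOp_apply]
  have : ∑ o', siteVec N coinData ⟨w, o'⟩ * memVec v ⟨w, o'⟩ = 0 := by
    rw [Fintype.sum_option, h, zero_mul, zero_add]
    exact Finset.sum_eq_zero fun i _ => by
      rw [memVec_some, mul_zero]
  show _ - _ * ∑ o', siteVec N coinData ⟨w, o'⟩ * memVec v ⟨w, o'⟩ = _
  rw [this, mul_zero, sub_zero]

/-! ### The walk and Chebyshev polynomials -/

/-- The walk of `m + 1` steps: `m` coins between `m + 1` moves. -/
noncomputable def walkOp (N : Network G) (m : ℕ) : Module.End ℝ (Site G → ℝ) :=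
  (flipOp N * reflectOp N coinData) ^ m * flipOp N

theorem walkOp_succ (N : Network G) (m : ℕ) :
    walkOp N (m + 1) = flipOp N * reflectOp N coinData * walkOp N m := by
  rw [walkOp, walkOp, pow_succ', mul_assoc]

theorem walkOp_succ' (N : Network G) (m : ℕ) :
    walkOp N (m + 1) = walkOp N m * (reflectOp N coinData * flipOp N) := by
  rw [walkOp, walkOp, pow_succ]; simp only [mul_assoc]

/-- The walk is a palindrome of involutions. -/
theorem walkOp_mul_self (N : Network G) (m : ℕ) : walkOp N m * walkOp N m = 1 := by
  induction m with
  | zero => simp [walkOp, flipOp_mul_self]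
  | succ m ih =>
    rw [walkOp_succ N m]
    nth_rewrite 2 [← walkOp_succ N m]
    rw [walkOp_succ']
    calc flipOp N * reflectOp N coinData * walkOp N m *
          (walkOp N m * (reflectOp N coinData * flipOp N))
        = flipOp N * reflectOp N coinData * (walkOp N m * walkOp N m) *
          (reflectOp N coinData * flipOp N) := by simp only [mul_assoc]
      _ = flipOp N * (reflectOp N coinData * reflectOp N coinData) * flipOp N := by
          rw [ih]; simp only [mul_assoc, one_mul]
      _ = 1 := by
          rw [reflectOp_mul_self N isReflectionData_coinData, mul_one, flipOp_mul_self]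

theorem walkOp_dotProduct (N : Network G) (m : ℕ) (α β : Site G → ℝ) :
    walkOp N m α ⬝ᵥ β = α ⬝ᵥ walkOp N m β := by
  induction m generalizing α β with
  | zero => simpa [walkOp] using flipOp_dotProduct N α β
  | succ m ih =>
    nth_rewrite 1 [walkOp_succ]
    rw [walkOp_succ', Module.End.mul_apply, Module.End.mul_apply, flipOp_dotProduct,
      reflectOp_dotProduct, ih]
    rfl

theorem walkOp_memVec (N : Network G) (m : ℕ) (v : V) : walkOp N m (memVec v) = memVec v := by
  induction m with
  | zero => simp [walkOp, flipOp_memVec]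
  | succ m ih =>
    rw [walkOp_succ, Module.End.mul_apply, ih, Module.End.mul_apply, coin_memVec, flipOp_memVec]

/-- A function on the nodes as a state of the walker on the ports. -/
def portLift (h : V → ℝ) : Site G → ℝ
  | ⟨_, none⟩ => 0
  | ⟨v, some _⟩ => h v

theorem coin_apply_some (N : Network G) (α : Site G → ℝ) (v : V) (i : Fin (G.degree v)) :
    reflectOp N coinData α ⟨v, some i⟩ =
      α ⟨v, some i⟩ - 2 * ((∑ j, α ⟨v, some j⟩) / G.degree v) := by
  have hd : (0 : ℝ) < G.degree v := by exact_mod_cast i.pos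
  have h := Real.mul_self_sqrt hd.le
  have h0 := (Real.sqrt_pos.2 hd).ne'
  rw [reflectOp_apply, Fintype.sum_option]
  simp only [siteVec, slotVec, coinData]
  simp only [ite_self, zero_mul, zero_add]
  have e2 : ∑ j, 1 / √(G.degree v : ℝ) * α ⟨v, some j⟩ =
    1 / √(G.degree v : ℝ) * ∑ j, α ⟨v, some j⟩ := (Finset.mul_sum _ _ _).symm
  rw [e2]
  have e : 1 / √(G.degree v : ℝ) * (1 / √(G.degree v)) = 1 / G.degree v := by
    rw [div_mul_div_comm, h, one_mul]
  linear_combination (-2 * ∑ j, α ⟨v, some j⟩) * e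

theorem coin_apply_none (N : Network G) (α : Site G → ℝ) (v : V) :
    reflectOp N coinData α ⟨v, none⟩ = α ⟨v, none⟩ := by
  rw [reflectOp_apply]
  simp [siteVec, slotVec, coinData]

/-- One step of the walk follows the recurrence of the Chebyshev polynomials of the transition
operator. -/
theorem step_portLift (N : Network G) (x y : V → ℝ) :
    flipOp N (reflectOp N coinData (flipOp N (portLift x) - portLift y)) =
      -(flipOp N (portLift ((2 : ℝ) • avgOp N x - y)) - portLift x) := by
  have key : reflectOp N coinData (flipOp N (portLift x) - portLift y) =
      flipOp N (portLift x) - portLift ((2 : ℝ) • avgOp N x - y) := by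
    ext ⟨v, o⟩
    rcases o with _ | i
    · rw [coin_apply_none]; rfl
    · rw [coin_apply_some]
      have hd : (0 : ℝ) < G.degree v := by exact_mod_cast i.pos
      show x (N.port v i) - y v - 2 * ((∑ j, (x (N.port v j) - y v)) / G.degree v) =
        x (N.port v i) - (2 * ((∑ i, x (N.port v i)) / G.degree v) - y v)
      rw [Finset.sum_sub_distrib]
      simp only [Finset.sum_const, Finset.card_univ, Fintype.card_fin, nsmul_eq_mul]
      field_simp
      ring
  have hff : ∀ α, flipOp N (flipOp N α) = α := fun α => by
    rw [← Module.End.mul_apply, flipOp_mul_self]; rfl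
  rw [key, map_sub, hff, neg_sub]

theorem walkOp_portLift (N : Network G) (m : ℕ) (h : V → ℝ) :
    walkOp N m (portLift h) = (-1 : ℝ) ^ m •
      (flipOp N (portLift (aeval (avgOp N) (Chebyshev.U ℝ m) h)) -
        portLift (aeval (avgOp N) (Chebyshev.U ℝ (m - 1)) h)) := by
  induction m with
  | zero =>
    have h0 : (portLift (0 : V → ℝ) : Site G → ℝ) = 0 := by
      ext ⟨v, o⟩; rcases o with _ | i <;> rfl
    simp [walkOp, h0]
  | succ m ih =>
    have hU : aeval (avgOp N) (Chebyshev.U ℝ ((m + 1 : ℕ) : ℤ)) h =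
        (2 : ℝ) • avgOp N (aeval (avgOp N) (Chebyshev.U ℝ m) h) -
          aeval (avgOp N) (Chebyshev.U ℝ (m - 1)) h := by
      rw [Nat.cast_succ, Chebyshev.U_add_one]
      simp [Module.End.mul_apply, two_smul, two_mul]
    rw [walkOp_succ, Module.End.mul_apply, ih, map_smul, Module.End.mul_apply, step_portLift, hU,
      pow_succ, mul_smul, Nat.cast_succ, add_sub_cancel_right]
    simp

/-- The amplitude at the ports of `w` after the walk from the ports of `v` is, up to sign, an entry
of a Chebyshev polynomial of the transition operator. -/
theorem portVec_dotProduct_walkOp (N : Network G) (m : ℕ) {v w : V}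
    (hd : G.degree v = G.degree w) (hw : G.degree w ≠ 0) :
    portVec w ⬝ᵥ walkOp N m (portVec v) = (-1) ^ m *
      aeval (avgOp N) (Chebyshev.T ℝ ((m + 1 : ℕ) : ℤ)) (Pi.single v 1) w := by
  have hd' : (0 : ℝ) < G.degree w := by exact_mod_cast Nat.pos_of_ne_zero hw
  have h := Real.mul_self_sqrt hd'.le
  have h0 := (Real.sqrt_pos.2 hd').ne'
  have e : (portVec v : Site G → ℝ) = (1 / √(G.degree w)) • portLift (Pi.single v 1) := by
    ext ⟨u, o⟩
    rcases o with _ | i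
    · simp [portVec, portLift]
    · by_cases hu : u = v
      · subst hu; simp [portVec, portLift, hd]
      · simp [portVec, portLift, hu]
  have hT : aeval (avgOp N) (Chebyshev.T ℝ ((m + 1 : ℕ) : ℤ)) (Pi.single v 1) w =
      avgOp N (aeval (avgOp N) (Chebyshev.U ℝ m) (Pi.single v 1)) w -
        aeval (avgOp N) (Chebyshev.U ℝ (m - 1)) (Pi.single v 1) w := by
    have := Chebyshev.T_eq_X_mul_U_sub_U ℝ ((m : ℤ) - 1)
    rw [show (m : ℤ) - 1 + 2 = ((m + 1 : ℕ) : ℤ) by push_cast; ring, sub_add_cancel] at this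
    rw [this]
    simp [Module.End.mul_apply]
  rw [portVec_dotProduct, e, map_smul, walkOp_portLift, hT, avgOp_apply]
  set x := aeval (avgOp N) (Chebyshev.U ℝ m) (Pi.single v 1)
  set y := aeval (avgOp N) (Chebyshev.U ℝ (m - 1)) (Pi.single v 1)
  have hs : ∀ i : Fin (G.degree w), ((1 / √(G.degree w) : ℝ) • (-1 : ℝ) ^ m •
      (flipOp N (portLift x) - portLift y) : Site G → ℝ) ⟨w, some i⟩ =
      1 / √(G.degree w) * ((-1) ^ m * (x (N.port w i) - y w)) := fun i => rfl
  simp only [hs]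
  rw [← Finset.mul_sum, ← Finset.mul_sum, Finset.sum_sub_distrib]
  simp only [Finset.sum_const, Finset.card_univ, Fintype.card_fin, nsmul_eq_mul]
  field_simp
  rw [sq, h]

end Walk

/-! ### Exact amplitude amplification -/

/-- Alternating reflections about two unit vectors at an angle of `π / 2 - ϑ`, written without a
division by `cos ϑ`. -/
theorem two_reflections {ι : Type} [Fintype ι] {τ ψ : ι → ℝ} {ϑ : ℝ} (hτ : τ ⬝ᵥ τ = 1)
    (hψ : ψ ⬝ᵥ ψ = 1) (hτψ : τ ⬝ᵥ ψ = Real.sin ϑ) {v : ℕ → ι → ℝ} (h0 : v 0 = ψ) {k : ℕ}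
    (hv : ∀ j < k, ∃ w : ι → ℝ, w = v j - (2 * (τ ⬝ᵥ v j)) • τ ∧
      v (j + 1) = w - (2 * (ψ ⬝ᵥ w)) • ψ) {j : ℕ} (hj : j ≤ k) :
    Real.cos ϑ • v j = (-1 : ℝ) ^ j •
      (Real.sin (2 * j * ϑ) • τ + Real.cos ((2 * j + 1) * ϑ) • ψ) := by
  induction j with
  | zero => simp [h0]
  | succ j ih =>
    obtain ⟨w, hw, hvw⟩ := hv j hj
    have ih := ih (by omega)
    set s := Real.sin ϑ
    set x := Real.sin (2 * j * ϑ)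
    set y := Real.cos ((2 * j + 1) * ϑ)
    have hψτ : ψ ⬝ᵥ τ = s := by rw [dotProduct_comm]; exact hτψ
    have h1 : Real.cos ϑ * (τ ⬝ᵥ v j) = (-1 : ℝ) ^ j * (x + y * s) := by
      have := congrArg (fun u => τ ⬝ᵥ u) ih
      simpa [dotProduct_smul, dotProduct_add, hτ, hτψ, mul_add] using this
    have h2 : Real.cos ϑ • w = (-1 : ℝ) ^ j • (-(x + 2 * y * s) • τ + y • ψ) := by
      rw [hw, smul_sub, ih, smul_smul, show Real.cos ϑ * (2 * (τ ⬝ᵥ v j)) =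
        2 * (Real.cos ϑ * (τ ⬝ᵥ v j)) by ring, h1]
      module
    have h3 : Real.cos ϑ * (ψ ⬝ᵥ w) = (-1 : ℝ) ^ j * (-(x + 2 * y * s) * s + y) := by
      have := congrArg (fun u => ψ ⬝ᵥ u) h2
      simpa [dotProduct_smul, dotProduct_add, hψ, hψτ, mul_add] using this
    have e1 : x + 2 * y * s = Real.sin (2 * (j + 1 : ℕ) * ϑ) := by
      have := Real.sin_sub_sin (2 * (j + 1 : ℕ) * ϑ) (2 * j * ϑ)
      rw [show (2 * ((j + 1 : ℕ) : ℝ) * ϑ - 2 * j * ϑ) / 2 = ϑ by push_cast; ring,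
        show (2 * ((j + 1 : ℕ) : ℝ) * ϑ + 2 * j * ϑ) / 2 = (2 * j + 1) * ϑ by
          push_cast; ring] at this
      linear_combination -this
    have e2 : 2 * s * (x + 2 * y * s) - y = -Real.cos ((2 * (j + 1 : ℕ) + 1) * ϑ) := by
      rw [e1]
      have := Real.cos_sub_cos ((2 * (j + 1 : ℕ) + 1) * ϑ) ((2 * j + 1) * ϑ)
      rw [show ((2 * ((j + 1 : ℕ) : ℝ) + 1) * ϑ + (2 * j + 1) * ϑ) / 2 = 2 * (j + 1 : ℕ) * ϑ by
          push_cast; ring,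
        show ((2 * ((j + 1 : ℕ) : ℝ) + 1) * ϑ - (2 * j + 1) * ϑ) / 2 = ϑ by push_cast; ring] at this
      linear_combination this
    rw [hvw, smul_sub, h2, smul_smul, show Real.cos ϑ * (2 * (ψ ⬝ᵥ w)) =
      2 * (Real.cos ϑ * (ψ ⬝ᵥ w)) by ring, h3, ← e1,
      show Real.cos ((2 * (j + 1 : ℕ) + 1) * ϑ) = -(2 * s * (x + 2 * y * s) - y) by rw [e2]; ring,
      pow_succ]
    module

section Walk

variable {V : Type} [Fintype V] [DecidableEq V] {G : SimpleGraph V} [DecidableRel G.Adj]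

/-- The state of the walker before round `r`, if the nodes apply in round `i` the reflections
`c i`. The walker starts in the memory of `source`. -/
noncomputable def walkState (N : Network G) (c : ℕ → Role → ℝ × ℝ) : ℕ → Site G → ℝ
  | 0 => memVec N.source
  | r + 1 => flipOp N (reflectOp N (c r) (walkState N c r))

/-- The reflections of the routing algorithm. In round `0`, `source` sends the walker out with
amplitude `sin γ`. The rounds are grouped into `2 * k + 1` walks of `t` steps; between two walks,
`target` and `source` alternate in reflecting. After the last walk, `target` takes the walker into
its memory. -/
noncomputable def schedule (t k : ℕ) (γ : ℝ) (r : ℕ) : Role → ℝ × ℝ :=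
  if r = 0 then sourceData (Real.sin (γ / 2)) (-Real.cos (γ / 2))
  else if r = (2 * k + 1) * t then targetData (1 / √2) (-(1 / √2))
  else if r % t ≠ 0 then coinData
  else if Odd (r / t) then targetData 0 1
  else sourceData (Real.cos γ) (Real.sin γ)

theorem inv_sqrt_two_sq : (1 / √2 : ℝ) ^ 2 = 1 / 2 := by
  rw [div_pow, Real.sq_sqrt (by norm_num), one_pow]

theorem isReflectionData_schedule (t k : ℕ) (γ : ℝ) (r : ℕ) :
    IsReflectionData (schedule t k γ r) := by
  unfold schedule
  split_ifs
  · exact isReflectionData_sourceData (by rw [neg_sq]; exact Real.sin_sq_add_cos_sq _)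
  · refine isReflectionData_targetData ?_
    rw [neg_sq, inv_sqrt_two_sq]; norm_num
  · exact isReflectionData_coinData
  · exact isReflectionData_targetData (by norm_num)
  · exact isReflectionData_sourceData (Real.cos_sq_add_sin_sq _)

theorem walkState_walk (N : Network G) {t k : ℕ} (γ : ℝ) {q i : ℕ} (hq : q ≤ 2 * k) (hi : i < t) :
    walkState N (schedule t k γ) (q * t + 1 + i) =
      walkOp N i (reflectOp N (schedule t k γ (q * t)) (walkState N (schedule t k γ) (q * t))) := by
  induction i with
  | zero => simp [walkOp]; rfl
  | succ i ih =>
    have hlt : q * t + 1 + i < (2 * k + 1) * t := by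
      have : (q + 1) * t ≤ (2 * k + 1) * t := Nat.mul_le_mul_right _ (by omega)
      rw [Nat.succ_mul] at this
      omega
    have hmod : (q * t + 1 + i) % t = 1 + i := by
      rw [add_assoc, Nat.mul_add_mod', Nat.mod_eq_of_lt (by omega)]
    have hc : schedule t k γ (q * t + 1 + i) = coinData := by
      rw [schedule, if_neg (by omega), if_neg hlt.ne, if_pos (by omega)]
    rw [← add_assoc, walkState, ih (by omega), hc, walkOp_succ]
    rfl

theorem walkState_block (N : Network G) {t k : ℕ} (γ : ℝ) {q : ℕ} (hq : q ≤ 2 * k) (ht : 1 ≤ t) :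
    walkState N (schedule t k γ) ((q + 1) * t) =
      walkOp N (t - 1)
        (reflectOp N (schedule t k γ (q * t)) (walkState N (schedule t k γ) (q * t))) := by
  rw [← walkState_walk N γ hq (by omega)]
  congr 1
  rw [Nat.succ_mul]; omega

theorem schedule_odd {t k j : ℕ} (γ : ℝ) (ht : 1 ≤ t) (hj : j < k) :
    schedule t k γ ((2 * j + 1) * t) = targetData 0 1 := by
  have h1 : (2 * j + 1) * t ≠ (2 * k + 1) * t := fun h => by
    have := Nat.eq_of_mul_eq_mul_right ht h
    omega
  rw [schedule, if_neg (by positivity), if_neg h1, if_neg (by simp), if_pos]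
  rw [Nat.mul_div_cancel _ ht]
  exact odd_two_mul_add_one j

theorem schedule_even {t k j : ℕ} (γ : ℝ) (ht : 1 ≤ t) :
    schedule t k γ ((2 * j + 2) * t) = sourceData (Real.cos γ) (Real.sin γ) := by
  have h1 : (2 * j + 2) * t ≠ (2 * k + 1) * t := fun h => by
    have := Nat.eq_of_mul_eq_mul_right ht h
    omega
  rw [schedule, if_neg (by positivity), if_neg h1, if_neg (by simp), if_neg]
  rw [Nat.mul_div_cancel _ ht, Nat.not_odd_iff_even]
  exact ⟨j + 1, by ring⟩

/-- If the initial amplitude at the ports of `target` is adjusted to the sine of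
`π / (2 * (2 * k + 1))`, then after `k` iterations the walker is at `target` with certainty. -/
theorem walkState_final (N : Network G) (hst : N.source ≠ N.target)
    (hs : G.degree N.source ≠ 0) (ht : G.degree N.target ≠ 0) {t k : ℕ} {γ : ℝ}
    (ht1 : 1 ≤ t) (hk : 1 ≤ k)
    (hγ : Real.sin γ * (portVec N.target ⬝ᵥ walkOp N (t - 1) (portVec N.source)) =
      Real.sin (Real.pi / (2 * (2 * k + 1)))) :
    walkState N (schedule t k γ) ((2 * k + 1) * t + 1) = (-1 : ℝ) ^ k • memVec N.target := by
  set ϑ := Real.pi / (2 * (2 * k + 1)) with hϑ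
  have hk' : (1 : ℝ) ≤ k := by exact_mod_cast hk
  have hπ := Real.pi_pos
  have hϑ1 : (2 * k + 1) * ϑ = Real.pi / 2 := by rw [hϑ]; field_simp
  have hcos : 0 < Real.cos ϑ := by
    apply Real.cos_pos_of_mem_Ioo
    constructor <;> nlinarith [show 0 < ϑ by positivity]
  set W := walkOp N (t - 1) with hW
  have hWW : ∀ α, W (W α) = α := fun α => by
    rw [← Module.End.mul_apply, hW, walkOp_mul_self]; rfl
  set τ : Site G → ℝ := portVec N.target with hτ
  have hττ : τ ⬝ᵥ τ = 1 := portVec_dotProduct_self ht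
  -- the state that `source` sends out
  set g : Site G → ℝ := Real.cos γ • memVec N.source + Real.sin γ • portVec N.source with hg
  have hsrc : ∀ a b, siteVec N (sourceData a b) = a • memVec N.source + b • portVec N.source :=
    fun a b => by
      rw [siteVec_single N hs (fun w hw => sourceData_role_of_ne N a b hw), role_source]; rfl
  have htgt : ∀ a b, siteVec N (targetData a b) = a • memVec N.target + b • portVec N.target :=
    fun a b => by
      rw [siteVec_single N ht (fun w hw => targetData_role_of_ne N a b hw), role_target N hst]; rfl
  have hmp : (portVec N.source : Site G → ℝ) ⬝ᵥ memVec N.source = 0 := by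
    rw [dotProduct_comm]; exact memVec_dotProduct_portVec _ _
  have hgg : g ⬝ᵥ g = 1 := by
    simp only [hg, add_dotProduct, dotProduct_add, smul_dotProduct, dotProduct_smul, smul_eq_mul,
      memVec_dotProduct_self, portVec_dotProduct_self hs, memVec_dotProduct_portVec, hmp]
    linear_combination Real.cos_sq_add_sin_sq γ
  set ψ := W g with hψ
  have hψψ : ψ ⬝ᵥ ψ = 1 := by rw [hψ, hW, walkOp_dotProduct, ← hW, hWW, hgg]
  have hτψ : τ ⬝ᵥ ψ = Real.sin ϑ := by
    have h0 : τ ⬝ᵥ memVec N.source = 0 := by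
      rw [dotProduct_comm]; exact memVec_dotProduct_portVec _ _
    rw [hψ, hg, map_add, map_smul, map_smul, hW, walkOp_memVec, dotProduct_add, dotProduct_smul,
      dotProduct_smul, h0, smul_zero, zero_add, smul_eq_mul, hγ]
  have hfirst : walkState N (schedule t k γ) t = ψ := by
    have h := walkState_block N (t := t) (k := k) γ (q := 0) (Nat.zero_le _) ht1
    have h0 : schedule t k γ 0 = sourceData (Real.sin (γ / 2)) (-Real.cos (γ / 2)) := if_pos rfl
    rw [zero_add, one_mul, zero_mul, h0, reflectOp_eq_of_single N
      (fun w hw => sourceData_role_of_ne N _ _ hw), hsrc, walkState] at h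
    rw [h, hψ, hg, ← hW]
    congr 1
    have hc : Real.cos γ = 1 - 2 * Real.sin (γ / 2) ^ 2 := by
      have := Real.cos_sq' (γ / 2)
      have h2 := Real.cos_two_mul (γ / 2)
      rw [mul_div_cancel₀ γ (by norm_num : (2 : ℝ) ≠ 0)] at h2
      linear_combination h2 + 2 * this
    have hs' : Real.sin γ = 2 * Real.sin (γ / 2) * Real.cos (γ / 2) := by
      rw [← Real.sin_two_mul, mul_div_cancel₀ γ (by norm_num : (2 : ℝ) ≠ 0)]
    rw [hc, hs', add_dotProduct, smul_dotProduct, smul_dotProduct, memVec_dotProduct_self, hmp]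
    simp only [smul_eq_mul]
    module
  have hmain := two_reflections (v := fun j => walkState N (schedule t k γ) ((2 * j + 1) * t))
    (k := k) hττ hψψ hτψ (by simpa using hfirst) (fun j hj => by
      refine ⟨_, rfl, ?_⟩
      have h1 := walkState_block N (t := t) (k := k) γ (q := 2 * j + 1) (by omega) ht1
      have h2 := walkState_block N (t := t) (k := k) γ (q := 2 * j + 2) (by omega) ht1
      rw [show 2 * j + 1 + 1 = 2 * j + 2 from rfl, schedule_odd γ ht1 hj, reflectOp_eq_of_single N
        (fun w hw => targetData_role_of_ne N _ _ hw), htgt, zero_smul, zero_add, one_smul] at h1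
      rw [schedule_even γ ht1, reflectOp_eq_of_single N
        (fun w hw => sourceData_role_of_ne N _ _ hw), hsrc, h1, ← hW, ← hg, ← hτ] at h2
      rw [show 2 * (j + 1) + 1 = 2 * j + 2 + 1 by ring, h2, map_sub, hWW, map_smul, ← hψ]
      have hadj : ∀ α, g ⬝ᵥ W α = ψ ⬝ᵥ α := fun α => by rw [hψ, hW, walkOp_dotProduct]
      rw [hadj]) le_rfl
  have hlast : walkState N (schedule t k γ) ((2 * k + 1) * t) = (-1 : ℝ) ^ k • τ := by
    beta_reduce at hmain
    rw [hϑ1, Real.cos_pi_div_two, zero_smul, add_zero,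
      show 2 * (k : ℝ) * ϑ = Real.pi / 2 - ϑ by linarith, Real.sin_pi_div_two_sub,
      smul_comm] at hmain
    exact smul_right_injective _ hcos.ne' hmain
  have hsched : schedule t k γ ((2 * k + 1) * t) = targetData (1 / √2) (-(1 / √2)) := by
    rw [schedule, if_neg (by positivity), if_pos rfl]
  rw [walkState, hlast, hsched, map_smul, reflectOp_eq_of_single N
    (fun w hw => targetData_role_of_ne N _ _ hw), htgt, map_smul]
  congr 1
  rw [add_dotProduct, smul_dotProduct, smul_dotProduct, ← hτ, hττ, memVec_dotProduct_portVec]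
  have e : τ - (2 * ((1 / √2) • (0 : ℝ) + (-(1 / √2)) • (1 : ℝ))) •
      ((1 / √2 : ℝ) • memVec N.target + (-(1 / √2) : ℝ) • τ) = memVec N.target := by
    have h2 := inv_sqrt_two_sq
    set a : ℝ := 1 / √2
    have h2' : 2 * a * a = 1 := by linear_combination 2 * h2
    simp only [smul_eq_mul, mul_zero, zero_add, mul_one]
    have : τ - (2 * -a) • (a • memVec N.target + -a • τ) =
        (2 * a * a) • memVec N.target + (1 - 2 * a * a) • τ := by module
    rw [this, h2']; simp
  rw [e, flipOp_memVec]

end Walk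

/-! ### The local unitaries -/

/-- What the work register of a node holds: its role and, for `source`, whether it still has
the data. -/
inductive Mark where
  | home
  | away
  | target
  | ordinary
deriving DecidableEq

instance : Fintype Mark :=
  ⟨{.home, .away, .target, .ordinary}, fun m => by cases m <;> decide⟩

/-- The mark of a node that does not hold the data. -/
def Role.mark : Role → Mark
  | .source => .away
  | .target => .target
  | .ordinary => .ordinary

/-- The role that a mark belongs to. -/
def Mark.role : Mark → Role
  | .home => .source
  | .away => .source
  | .target => .target
  | .ordinary => .ordinary

theorem Role.role_mark (ρ : Role) : ρ.mark.role = ρ := by cases ρ <;> rfl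

instance : DecidableEq Role :=
  (Function.LeftInverse.injective Role.role_mark).decidableEq

instance : Fintype Role :=
  ⟨{.source, .target, .ordinary}, fun ρ => by cases ρ <;> decide⟩

/-- The message that carries the data `y`: a leading bit, which makes it non-empty, and `y`. -/
def dataMsg {b : ℕ} (y : Bits b) : Msg (b + 1) :=
  ⟨Fin.last (b + 1), (Fin.cons true y : Fin (b + 1) → Bool)⟩

theorem dataMsg_injective {b : ℕ} : Function.Injective (dataMsg (b := b)) := by
  intro y y' h
  have h' : (Fin.cons true y : Fin (b + 1) → Bool) = Fin.cons true y' := by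
    simpa [dataMsg] using h
  exact (Fin.cons_injective2 h').2

theorem dataMsg_ne_empty {b : ℕ} (y : Bits b) : dataMsg y ≠ Msg.empty (b + 1) := by
  intro h
  have := congrArg Msg.size h
  simp [dataMsg, Msg.size, Msg.empty] at this

/-- The configurations of a node of degree `d`, in the routing algorithm for `b`-bit data. -/
abbrev WalkConf (b d : ℕ) : Type := NodeConf Mark b 1 (b + 1) d

/-- The configuration of a node where the walker is not. -/
def idleConf (b d : ℕ) (ρ : Role) : WalkConf b d :=
  ⟨ρ.mark, fun _ _ => false, none, fun _ => Msg.empty _, fun _ => Msg.empty _⟩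

/-- The configuration, before the local unitary, of a node at which the walker is with data `y`. At
a port it is the received message. The memory is the input register at `source`, and the output
register at the other nodes. -/
def slotConf {b d : ℕ} (ρ : Role) (o : Option (Fin d)) (y : Bits b) : WalkConf b d :=
  match o, ρ with
  | some i, ρ => { idleConf b d ρ with
      recv := fun j => if j = i then dataMsg y else Msg.empty _ }
  | none, .source => { idleConf b d .source with work := .home, input := fun _ => y }
  | none, ρ => { idleConf b d ρ with output := some y }

theorem slotConf_emit {b d : ℕ} (ρ : Role) (o : Option (Fin d)) (y : Bits b) (i : Fin d) :
    (slotConf ρ o y).emit i = Msg.empty _ := by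
  rcases o with _ | j <;> cases ρ <;> rfl

theorem slotConf_none_recv {b d : ℕ} (ρ : Role) (y : Bits b) (i : Fin d) :
    (slotConf ρ none y).recv i = Msg.empty _ := by
  cases ρ <;> rfl

theorem slotConf_some_recv {b d : ℕ} (ρ : Role) (i : Fin d) (y : Bits b) (j : Fin d) :
    (slotConf ρ (some i) y).recv j = if j = i then dataMsg y else Msg.empty _ := by
  cases ρ <;> rfl

theorem slotConf_role {b d : ℕ} (ρ : Role) (o : Option (Fin d)) (y : Bits b) :
    (slotConf ρ o y).work.role = ρ := by
  rcases o with _ | j <;> cases ρ <;> rfl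

theorem slotConf_injective {b d : ℕ} :
    Function.Injective fun s : Role × Option (Fin d) × Bits b => slotConf s.1 s.2.1 s.2.2 := by
  rintro ⟨ρ, o, y⟩ ⟨ρ', o', y'⟩ h
  simp only at h
  obtain rfl : ρ = ρ' := by
    have := congrArg (fun c => c.work.role) h
    simpa only [slotConf_role] using this
  rcases o with _ | i <;> rcases o' with _ | i'
  · have : y = y' := by
      cases ρ
      · exact congrFun (congrArg NodeConf.input h) 0
      · exact Option.some_injective _ (congrArg NodeConf.output h)
      · exact Option.some_injective _ (congrArg NodeConf.output h)
    rw [this]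
  · have := congrFun (congrArg NodeConf.recv h) i'
    rw [slotConf_none_recv, slotConf_some_recv, if_pos rfl] at this
    exact absurd this.symm (dataMsg_ne_empty _)
  · have := congrFun (congrArg NodeConf.recv h) i
    rw [slotConf_none_recv, slotConf_some_recv, if_pos rfl] at this
    exact absurd this (dataMsg_ne_empty _)
  · have := congrFun (congrArg NodeConf.recv h) i
    rw [slotConf_some_recv, slotConf_some_recv, if_pos rfl] at this
    split_ifs at this with hi
    · rw [hi, dataMsg_injective this]
    · exact absurd this (dataMsg_ne_empty _)

theorem idleConf_ne_slotConf {b d : ℕ} (ρ ρ' : Role) (o : Option (Fin d)) (y : Bits b) :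
    idleConf b d ρ ≠ slotConf ρ' o y := by
  intro h
  rcases o with _ | i
  · have h1 := congrArg NodeConf.work h
    have h2 := congrArg NodeConf.output h
    cases ρ' <;> cases ρ <;> simp [slotConf, idleConf, Role.mark] at h1 h2
  · have := congrFun (congrArg NodeConf.recv h) i
    rw [slotConf_some_recv, if_pos rfl] at this
    exact dataMsg_ne_empty _ this.symm

/-- Exchange of the emission and the reception registers of a node. -/
def NodeConf.swap {W : Type} {b K L d : ℕ} (x : NodeConf W b K L d) : NodeConf W b K L d :=
  { x with emit := x.recv, recv := x.emit }

theorem NodeConf.swap_swap {W : Type} {b K L d : ℕ} (x : NodeConf W b K L d) :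
    x.swap.swap = x := rfl

/-- The projector onto the span of the vectors `slotVec (c ρ) d`, for all roles `ρ` and all data,
in the coordinates `slotConf`. -/
noncomputable def slotProj (b d : ℕ) (c : Role → ℝ × ℝ) :
    Matrix (Role × Option (Fin d) × Bits b) (Role × Option (Fin d) × Bits b) ℂ :=
  fun s s' => if s.1 = s'.1 ∧ s.2.2 = s'.2.2 then
    ((slotVec (c s.1) d s.2.1 * slotVec (c s.1) d s'.2.1 : ℝ) : ℂ) else 0

/-- The isometry that turns a state of the walker at a node into a state of that node. -/
def slotEmbedding (b d : ℕ) : Matrix (WalkConf b d) (Role × Option (Fin d) × Bits b) ℂ :=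
  fun x s => if x = slotConf s.1 s.2.1 s.2.2 then 1 else 0

section

open Matrix

theorem slotEmbedding_isometry (b d : ℕ) : (slotEmbedding b d)ᴴ * slotEmbedding b d = 1 := by
  ext s s'
  rw [mul_apply, one_apply]
  simp only [conjTranspose_apply, slotEmbedding]
  rw [Finset.sum_eq_single (slotConf s.1 s.2.1 s.2.2)]
  · by_cases h : s = s'
    · subst h; simp
    · rw [if_neg h, if_neg (fun e => h (slotConf_injective e)), mul_zero]
  · intro x _ hx
    rw [if_neg hx, star_zero, zero_mul]
  · intro h; exact absurd (Finset.mem_univ _) h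

theorem slotProj_conjTranspose (b d : ℕ) (c : Role → ℝ × ℝ) :
    (slotProj b d c)ᴴ = slotProj b d c := by
  ext ⟨ρ, o, y⟩ ⟨ρ', o', y'⟩
  simp only [conjTranspose_apply, slotProj]
  by_cases h : ρ = ρ' ∧ y = y'
  · obtain ⟨rfl, rfl⟩ := h
    simp [mul_comm]
  · rw [if_neg h, if_neg (fun e => h ⟨e.1.symm, e.2.symm⟩), star_zero]

theorem slotProj_mul_self (b d : ℕ) {c : Role → ℝ × ℝ} (hc : IsReflectionData c) :
    slotProj b d c * slotProj b d c = slotProj b d c := by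
  ext ⟨ρ, o, y⟩ ⟨ρ', o', y'⟩
  rw [mul_apply]
  simp only [slotProj, Fintype.sum_prod_type]
  rw [Finset.sum_eq_single ρ]
  · rw [Finset.sum_comm, Finset.sum_eq_single y]
    · simp only [and_self, if_true]
      by_cases h : ρ = ρ' ∧ y = y'
      · simp only [if_pos h]
        have hr : ∑ o₁, (slotVec (c ρ) d o * slotVec (c ρ) d o₁) *
            (slotVec (c ρ) d o₁ * slotVec (c ρ) d o') =
            slotVec (c ρ) d o * slotVec (c ρ) d o' := by
          rw [← congrArg (· * slotVec (c ρ) d o') (sum_slotVec_sq_mul hc ρ o), mul_assoc,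
            Finset.sum_mul]
          exact Finset.sum_congr rfl fun o₁ _ => by ring
        exact_mod_cast congrArg Complex.ofReal hr
      · simp [if_neg h]
    · intro z _ hz
      exact Finset.sum_eq_zero fun o _ => by rw [if_neg (fun h => hz h.2.symm), zero_mul]
    · intro h; exact absurd (Finset.mem_univ _) h
  · intro σ _ hσ
    refine Finset.sum_eq_zero fun o _ => Finset.sum_eq_zero fun z _ => ?_
    rw [if_neg (fun h => hσ h.1.symm), zero_mul]
  · intro h; exact absurd (Finset.mem_univ _) h

/-- Before the messages are sent, the walker at a node is reflected about the hyperplane orthogonal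
to the vectors `slotVec (c ρ) d`. -/
noncomputable def slotReflection (b d : ℕ) (c : Role → ℝ × ℝ) :
    Matrix (WalkConf b d) (WalkConf b d) ℂ :=
  1 - (2 : ℂ) • (slotEmbedding b d * slotProj b d c * (slotEmbedding b d)ᴴ)

theorem slotReflection_isometry (b d : ℕ) {c : Role → ℝ × ℝ} (hc : IsReflectionData c) :
    (slotReflection b d c)ᴴ * slotReflection b d c = 1 := by
  set Q := slotEmbedding b d * slotProj b d c * (slotEmbedding b d)ᴴ with hQ
  have h1 : Qᴴ = Q := by
    rw [hQ, conjTranspose_mul, conjTranspose_mul, conjTranspose_conjTranspose,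
      slotProj_conjTranspose, Matrix.mul_assoc]
  have h2 : Q * Q = Q := by
    calc Q * Q = slotEmbedding b d * slotProj b d c *
          ((slotEmbedding b d)ᴴ * slotEmbedding b d) * slotProj b d c * (slotEmbedding b d)ᴴ := by
          simp only [hQ, Matrix.mul_assoc]
      _ = slotEmbedding b d * (slotProj b d c * slotProj b d c) * (slotEmbedding b d)ᴴ := by
          rw [slotEmbedding_isometry, Matrix.mul_one, Matrix.mul_assoc (slotEmbedding b d)]
      _ = Q := by rw [slotProj_mul_self b d hc]
  have h3 : (slotReflection b d c)ᴴ = slotReflection b d c := by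
    rw [slotReflection, ← hQ, conjTranspose_sub, conjTranspose_smul, h1, conjTranspose_one]
    simp
  rw [h3, slotReflection, ← hQ]
  simp only [sub_mul, mul_sub, Matrix.smul_mul, Matrix.mul_smul, h2, Matrix.one_mul,
    Matrix.mul_one]
  module

/-- The entries of the reflection in the column of a state of the walker. -/
theorem slotReflection_apply_slotConf (b d : ℕ) (c : Role → ℝ × ℝ) (x : WalkConf b d) (ρ : Role)
    (o : Option (Fin d)) (y : Bits b) :
    slotReflection b d c x (slotConf ρ o y) = (if x = slotConf ρ o y then 1 else 0) -
      2 * ∑ o', ((slotVec (c ρ) d o' * slotVec (c ρ) d o : ℝ) : ℂ) *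
        (if x = slotConf ρ o' y then 1 else 0) := by
  rw [slotReflection, Matrix.sub_apply, Matrix.smul_apply, one_apply, smul_eq_mul]
  congr 2
  rw [mul_apply, Finset.sum_eq_single (ρ, o, y)]
  · rw [conjTranspose_apply, slotEmbedding, if_pos rfl, star_one, mul_one, mul_apply]
    simp only [slotProj, slotEmbedding, Fintype.sum_prod_type]
    rw [Finset.sum_eq_single ρ]
    · rw [Finset.sum_comm, Finset.sum_eq_single y]
      · simp only [and_self, if_true]
        exact Finset.sum_congr rfl fun o' _ => mul_comm _ _
      · intro z _ hz
        exact Finset.sum_eq_zero fun o' _ => by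
          rw [if_neg (fun h : ρ = ρ ∧ z = y => hz h.2), mul_zero]
      · intro h; exact absurd (Finset.mem_univ _) h
    · intro σ _ hσ
      refine Finset.sum_eq_zero fun o' _ => Finset.sum_eq_zero fun z _ => ?_
      rw [if_neg (fun h : σ = ρ ∧ z = y => hσ h.1), mul_zero]
    · intro h; exact absurd (Finset.mem_univ _) h
  · intro s _ hs
    rw [conjTranspose_apply, slotEmbedding,
      if_neg (fun h => hs (slotConf_injective h.symm)), star_zero, mul_zero]
  · intro h; exact absurd (Finset.mem_univ _) h

theorem slotReflection_apply_of_forall_ne (b d : ℕ) (c : Role → ℝ × ℝ) (x z : WalkConf b d)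
    (hz : (∀ ρ o y, z ≠ slotConf ρ o y) ∨ (∀ ρ o y, x ≠ slotConf ρ o y)) :
    slotReflection b d c x z = if x = z then 1 else 0 := by
  rw [slotReflection, Matrix.sub_apply, Matrix.smul_apply, one_apply, smul_eq_mul]
  have : (slotEmbedding b d * slotProj b d c * (slotEmbedding b d)ᴴ) x z = 0 := by
    rcases hz with h | h
    · rw [mul_apply]
      refine Finset.sum_eq_zero fun s _ => ?_
      rw [conjTranspose_apply, slotEmbedding, if_neg (h _ _ _), star_zero, mul_zero]
    · rw [Matrix.mul_assoc, mul_apply]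
      refine Finset.sum_eq_zero fun s _ => ?_
      rw [slotEmbedding, if_neg (h _ _ _), zero_mul]
  rw [this, mul_zero, sub_zero]

/-- The local unitary of a node: a reflection of the state of the walker, after which the contents
of the reception registers are moved to the emission registers. -/
noncomputable def localOp (b d : ℕ) (c : Role → ℝ × ℝ) : Matrix (WalkConf b d) (WalkConf b d) ℂ :=
  fun x z => slotReflection b d c x.swap z

theorem localOp_mem_unitaryGroup (b d : ℕ) {c : Role → ℝ × ℝ} (hc : IsReflectionData c) :
    localOp b d c ∈ Matrix.unitaryGroup (WalkConf b d) ℂ := by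
  rw [mem_unitaryGroup_iff']
  let σ : WalkConf b d ≃ WalkConf b d :=
    ⟨NodeConf.swap, NodeConf.swap, NodeConf.swap_swap, NodeConf.swap_swap⟩
  have h : localOp b d c = (slotReflection b d c).submatrix σ id := rfl
  rw [h, star_eq_conjTranspose, conjTranspose_submatrix, submatrix_mul_equiv,
    slotReflection_isometry b d hc, submatrix_id_id]

theorem localOp_clears (b d : ℕ) (c : Role → ℝ × ℝ) (x y : WalkConf b d)
    (hx : ∀ i, x.emit i = Msg.empty _) (hy : ∃ i, y.recv i ≠ Msg.empty _) :
    localOp b d c y x = 0 := by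
  obtain ⟨i, hi⟩ := hy
  have h1 : ∀ ρ o z, y.swap ≠ slotConf ρ o z := fun ρ o z h => by
    have := congrFun (congrArg NodeConf.emit h) i
    rw [slotConf_emit] at this
    exact hi this
  rw [localOp, slotReflection_apply_of_forall_ne b d c _ _ (Or.inr h1), if_neg]
  intro h
  exact hi ((congrFun (congrArg NodeConf.emit h) i).trans (hx i))

theorem localOp_apply_idleConf (b d : ℕ) (c : Role → ℝ × ℝ) (x : WalkConf b d) (ρ : Role) :
    localOp b d c x (idleConf b d ρ) = if x = idleConf b d ρ then 1 else 0 := by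
  rw [localOp, slotReflection_apply_of_forall_ne b d c _ _
    (Or.inl fun ρ' o y => idleConf_ne_slotConf ρ ρ' o y)]
  refine if_congr ⟨fun h => ?_, fun h => ?_⟩ rfl rfl
  · rw [← NodeConf.swap_swap x, h]; rfl
  · rw [h]; rfl

end

/-! ### The routing algorithm -/

/-- The algorithm in which a single walker carries the data through the network, and the nodes
apply in round `r` the reflections `c r`. -/
noncomputable abbrev walkAlgorithm (b : ℕ) (c : ℕ → Role → ℝ × ℝ)
    (hc : ∀ r, IsReflectionData (c r)) (R : ℕ) : QAlgorithm b where
  Work := Mark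
  copies := 1
  maxLen := b + 1
  rounds := R
  init _ ρ := match ρ with
    | .source => .home
    | .target => .target
    | .ordinary => .ordinary
  op r d := ⟨localOp b d (c r), localOp_mem_unitaryGroup b d (hc r)⟩
  op_clears r d x y hx hy := localOp_clears b d (c r) x y hx hy

section Network

variable {V : Type} [Fintype V] {G : SimpleGraph V} [DecidableRel G.Adj]

theorem deliver_deliver (b : ℕ) (c : ℕ → Role → ℝ × ℝ) (hc : ∀ r, IsReflectionData (c r)) (R : ℕ)
    (N : Network G) (x : (walkAlgorithm b c hc R).Config G) :
    (walkAlgorithm b c hc R).deliver N ((walkAlgorithm b c hc R).deliver N x) = x := by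
  have key : ∀ (u : V) (i : Fin (G.degree u)) {β : Type} (f : ∀ v, Fin (G.degree v) → β),
      f (N.port (N.port u i) (N.backPort u i)) (N.backPort (N.port u i) (N.backPort u i)) =
        f u i := by
    intro u i β f
    have h := siteFlip_siteFlip N ⟨u, some i⟩
    have := congrArg (fun s : Site G => s.2.map (f s.1)) h
    exact Option.some_injective _ this
  funext u
  show ({ x u with emit := _, recv := _ } : WalkConf b (G.degree u)) = x u
  have h1 : (fun i => (x (N.port (N.port u i) (N.backPort u i))).emit
      (N.backPort (N.port u i) (N.backPort u i))) = (x u).emit :=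
    funext fun i => key u i fun v => (x v).emit
  have h2 : (fun i => (x (N.port (N.port u i) (N.backPort u i))).recv
      (N.backPort (N.port u i) (N.backPort u i))) = (x u).recv :=
    funext fun i => key u i fun v => (x v).recv
  exact congrArg₂ (fun e r => ({ x u with emit := e, recv := r } : WalkConf b (G.degree u))) h1 h2

variable [DecidableEq V] (b : ℕ)

/-- The configuration of the network when the walker is nowhere. -/
def idleNet (N : Network G) (v : V) : WalkConf b (G.degree v) :=
  idleConf b (G.degree v) (N.role v)

/-- The configuration of the network before the local unitaries, with the walker at the site `s`
carrying the data `y`. -/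
def siteConf {b : ℕ} (N : Network G) (s : Site G) (y : Bits b) :
    ∀ v, WalkConf b (G.degree v) :=
  Function.update (idleNet b N) s.1 (slotConf (N.role s.1) s.2 y)

/-- The configuration of the network after the local unitaries, when the walker at a port is in an
emission register. -/
def sentConf {b : ℕ} (N : Network G) (s : Site G) (y : Bits b) :
    ∀ v, WalkConf b (G.degree v) :=
  Function.update (idleNet b N) s.1 (slotConf (N.role s.1) s.2 y).swap

theorem siteConf_some {b : ℕ} (N : Network G) (v : V) (i : Fin (G.degree v)) (y : Bits b) (u : V) :
    siteConf N ⟨v, some i⟩ y u = { idleNet b N u with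
      recv := fun j => if (⟨u, some j⟩ : Site G) = ⟨v, some i⟩ then dataMsg y
        else Msg.empty _ } := by
  by_cases h : u = v
  · subst h
    rw [siteConf, Function.update_self]
    simp [slotConf, idleNet]
  · rw [siteConf, Function.update_of_ne h]
    have : ∀ j, (⟨u, some j⟩ : Site G) ≠ ⟨v, some i⟩ := fun j e => h (congrArg Sigma.fst e)
    simp only [this, if_false]
    rfl

theorem sentConf_some {b : ℕ} (N : Network G) (v : V) (i : Fin (G.degree v)) (y : Bits b) (u : V) :
    sentConf N ⟨v, some i⟩ y u = { idleNet b N u with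
      emit := fun j => if (⟨u, some j⟩ : Site G) = ⟨v, some i⟩ then dataMsg y
        else Msg.empty _ } := by
  by_cases h : u = v
  · subst h
    rw [sentConf, Function.update_self]
    simp [slotConf, idleNet, NodeConf.swap, idleConf]
  · rw [sentConf, Function.update_of_ne h]
    have : ∀ j, (⟨u, some j⟩ : Site G) ≠ ⟨v, some i⟩ := fun j e => h (congrArg Sigma.fst e)
    simp only [this, if_false]
    rfl

theorem sentConf_none {b : ℕ} (N : Network G) (v : V) (y : Bits b) :
    sentConf N ⟨v, none⟩ y = siteConf N ⟨v, none⟩ y := by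
  rw [sentConf, siteConf]
  congr 1
  show (slotConf (N.role v) none y).swap = slotConf (N.role v) none y
  cases N.role v <;> rfl

theorem siteConf_none_messages {b : ℕ} (N : Network G) (v : V) (y : Bits b) (u : V)
    (i : Fin (G.degree u)) : (siteConf N ⟨v, none⟩ y u).emit i = Msg.empty _ ∧
      (siteConf N ⟨v, none⟩ y u).recv i = Msg.empty _ := by
  by_cases h : u = v
  · subst h
    rw [siteConf, Function.update_self]
    exact ⟨slotConf_emit _ _ _ _, slotConf_none_recv _ _ _⟩
  · rw [siteConf, Function.update_of_ne h]
    exact ⟨rfl, rfl⟩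

theorem siteConf_none_injective {b : ℕ} (N : Network G) (v : V) :
    Function.Injective (siteConf (b := b) N ⟨v, none⟩) := by
  intro y y' h
  have := congrFun h v
  rw [siteConf, siteConf, Function.update_self, Function.update_self] at this
  have := slotConf_injective (a₁ := (N.role v, none, y)) (a₂ := (N.role v, none, y')) this
  simpa using this

variable (c : ℕ → Role → ℝ × ℝ) (hc : ∀ r, IsReflectionData (c r)) (R : ℕ)

theorem deliver_sentConf (N : Network G) (s : Site G) (y : Bits b) :
    (walkAlgorithm b c hc R).deliver N (sentConf N s y) = siteConf N (siteFlip N s) y := by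
  obtain ⟨v, _ | i⟩ := s
  · rw [sentConf_none]
    funext u
    exact congrArg₂
      (fun e r => ({ siteConf N ⟨v, none⟩ y u with emit := e, recv := r } : WalkConf b _))
      (funext fun j => ((siteConf_none_messages N v y _ _).2.trans
        (siteConf_none_messages N v y u j).1.symm))
      (funext fun j => ((siteConf_none_messages N v y _ _).1.trans
        (siteConf_none_messages N v y u j).2.symm))
  · funext u
    have e : siteFlip N ⟨v, some i⟩ = ⟨N.port v i, some (N.backPort v i)⟩ := rfl
    rw [e, siteConf_some, ← e]
    have h0 := sentConf_some N v i y u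
    have h1 : ∀ j, (sentConf N ⟨v, some i⟩ y (N.port u j)).recv (N.backPort u j) =
        Msg.empty (b + 1) := fun j => by rw [sentConf_some]; rfl
    have h2 : ∀ j, (sentConf N ⟨v, some i⟩ y (N.port u j)).emit (N.backPort u j) =
        if (⟨u, some j⟩ : Site G) = siteFlip N ⟨v, some i⟩ then dataMsg y
          else Msg.empty (b + 1) := fun j => by
      rw [sentConf_some]
      refine if_congr ⟨fun h => ?_, fun h => ?_⟩ rfl rfl
      · rw [← h]; exact (siteFlip_siteFlip N ⟨u, some j⟩).symm
      · have := congrArg (siteFlip N) h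
        rwa [siteFlip_siteFlip] at this
    show ({ sentConf N ⟨v, some i⟩ y u with
      emit := fun j => (sentConf N ⟨v, some i⟩ y (N.port u j)).recv (N.backPort u j)
      recv := fun j => (sentConf N ⟨v, some i⟩ y (N.port u j)).emit (N.backPort u j) } :
        WalkConf b _) = _
    simp only [h1, h2]
    rw [h0]
    rfl

/-- The state of the network when the walker is in the state `α` and carries the data `φ`. -/
noncomputable def walkerState (N : Network G) (φ : EuclideanSpace ℂ (Bits b)) (α : Site G → ℝ) :
    (walkAlgorithm b c hc R).State G :=
  fun x => ∑ s, ∑ y, (α s : ℂ) * φ y * if x = siteConf N s y then 1 else 0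

/-- The same, after the local unitaries. -/
noncomputable def sentState (N : Network G) (φ : EuclideanSpace ℂ (Bits b)) (α : Site G → ℝ) :
    (walkAlgorithm b c hc R).State G :=
  fun x => ∑ s, ∑ y, (α s : ℂ) * φ y * if x = sentConf N s y then 1 else 0

theorem prod_localOp (N : Network G) (r : ℕ) (v : V) (o : Option (Fin (G.degree v))) (y : Bits b)
    (x : ∀ v, WalkConf b (G.degree v)) :
    ∏ w, localOp b (G.degree w) (c r) (x w) (siteConf N ⟨v, o⟩ y w) =
      (if x = sentConf N ⟨v, o⟩ y then 1 else 0) -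
        2 * ∑ o', ((siteVec N (c r) ⟨v, o'⟩ * siteVec N (c r) ⟨v, o⟩ : ℝ) : ℂ) *
          (if x = sentConf N ⟨v, o'⟩ y then 1 else 0) := by
  set P : ℂ := ∏ w ∈ Finset.univ.erase v, if x w = idleNet b N w then 1 else 0 with hP
  have hsent : ∀ o' : Option (Fin (G.degree v)),
      (if x = sentConf N ⟨v, o'⟩ y then (1 : ℂ) else 0) =
        (if (x v).swap = slotConf (N.role v) o' y then 1 else 0) * P := by
    intro o'
    have hiff : x = sentConf N ⟨v, o'⟩ y ↔ (x v).swap = slotConf (N.role v) o' y ∧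
        ∀ w ∈ Finset.univ.erase v, x w = idleNet b N w := by
      constructor
      · rintro rfl
        refine ⟨?_, fun w hw => ?_⟩
        · rw [sentConf, Function.update_self]; rfl
        · rw [sentConf, Function.update_of_ne (Finset.ne_of_mem_erase hw)]
      · intro h
        funext w
        by_cases hw : w = v
        · subst hw
          rw [sentConf, Function.update_self]
          exact congrArg NodeConf.swap h.1
        · rw [sentConf, Function.update_of_ne hw]
          exact h.2 w (Finset.mem_erase.2 ⟨hw, Finset.mem_univ _⟩)
    rw [hP, Finset.prod_ite_zero, Finset.prod_const_one]
    by_cases h1 : (x v).swap = slotConf (N.role v) o' y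
    · by_cases h2 : ∀ w ∈ Finset.univ.erase v, x w = idleNet b N w
      · rw [if_pos (hiff.2 ⟨h1, h2⟩), if_pos h1, if_pos h2, one_mul]
      · rw [if_neg (fun h => h2 (hiff.1 h).2), if_neg h2, mul_zero]
    · rw [if_neg (fun h => h1 (hiff.1 h).1), if_neg h1, zero_mul]
  have hrest : ∏ w ∈ Finset.univ.erase v,
      localOp b (G.degree w) (c r) (x w) (siteConf N ⟨v, o⟩ y w) = P := by
    refine Finset.prod_congr rfl fun w hw => ?_
    rw [siteConf, Function.update_of_ne (Finset.ne_of_mem_erase hw)]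
    exact localOp_apply_idleConf b _ (c r) (x w) (N.role w)
  rw [← Finset.mul_prod_erase _ _ (Finset.mem_univ v), hrest, siteConf, Function.update_self,
    localOp, slotReflection_apply_slotConf]
  simp only [hsent]
  rw [sub_mul, mul_assoc 2, Finset.sum_mul]
  simp only [mul_assoc]
  rfl

theorem localStep_walkerState (N : Network G) (φ : EuclideanSpace ℂ (Bits b)) (r : ℕ)
    (α : Site G → ℝ) :
    (walkAlgorithm b c hc R).localStep r (walkerState b c hc R N φ α) =
      sentState b c hc R N φ (reflectOp N (c r) α) := by
  funext x
  have h1 : (walkAlgorithm b c hc R).localStep r (walkerState b c hc R N φ α) x =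
      ∑ s, ∑ y, (α s : ℂ) * φ y *
        ∏ w, localOp b (G.degree w) (c r) (x w) (siteConf N s y w) := by
    simp only [QAlgorithm.localStep, walkerState, Finset.mul_sum]
    rw [Finset.sum_comm]
    refine Finset.sum_congr rfl fun s _ => ?_
    rw [Finset.sum_comm]
    refine Finset.sum_congr rfl fun y _ => ?_
    rw [Finset.sum_eq_single (siteConf N s y)]
    · rw [if_pos rfl]; ring
    · intro x' _ hx'
      rw [if_neg hx']; ring
    · intro h; exact absurd (Finset.mem_univ _) h
  rw [h1, sentState, Fintype.sum_sigma, Fintype.sum_sigma]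
  refine Finset.sum_congr rfl fun v _ => ?_
  rw [Finset.sum_comm]
  rw [Finset.sum_comm (f := fun o y => ((reflectOp N (c r) α ⟨v, o⟩ : ℝ) : ℂ) * φ y *
    if x = sentConf N ⟨v, o⟩ y then 1 else 0)]
  refine Finset.sum_congr rfl fun y _ => ?_
  simp only [prod_localOp]
  simp only [reflectOp_apply]
  push_cast
  simp only [mul_sub, sub_mul, Finset.sum_sub_distrib]
  congr 1
  simp only [Finset.mul_sum, Finset.sum_mul]
  rw [Finset.sum_comm]
  refine Finset.sum_congr rfl fun o _ => Finset.sum_congr rfl fun o' _ => ?_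
  ring

theorem sentState_deliver (N : Network G) (φ : EuclideanSpace ℂ (Bits b)) (α : Site G → ℝ) :
    (fun x => sentState b c hc R N φ α ((walkAlgorithm b c hc R).deliver N x)) =
      walkerState b c hc R N φ (flipOp N α) := by
  funext x
  rw [sentState, walkerState]
  let σ : Site G ≃ Site G := ⟨siteFlip N, siteFlip N, siteFlip_siteFlip N, siteFlip_siteFlip N⟩
  refine Fintype.sum_equiv σ _ _ fun s => Finset.sum_congr rfl fun y _ => ?_
  have e1 : flipOp N α (σ s) = α s := by
    show α (siteFlip N (siteFlip N s)) = α s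
    rw [siteFlip_siteFlip]
  rw [e1]
  congr 1
  refine if_congr ⟨fun h => ?_, fun h => ?_⟩ rfl rfl
  · rw [← deliver_deliver b c hc R N x, h, deliver_sentConf]; rfl
  · have : x = (walkAlgorithm b c hc R).deliver N (sentConf N s y) := by
      rw [deliver_sentConf]; exact h
    rw [this, deliver_deliver]

theorem initState_eq (N : Network G) (φ : EuclideanSpace ℂ (Bits b)) :
    (walkAlgorithm b c hc R).initState N φ = walkerState b c hc R N φ (memVec N.source) := by
  have hrole : N.role N.source = Role.source := role_source N
  funext x
  have hR : walkerState b c hc R N φ (memVec N.source) x =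
      φ ((x N.source).input 0) *
        if x = siteConf N ⟨N.source, none⟩ ((x N.source).input 0) then 1 else 0 := by
    rw [walkerState, Finset.sum_eq_single ⟨N.source, none⟩]
    · rw [Finset.sum_eq_single ((x N.source).input 0)]
      · simp [memVec]
      · intro y _ hy
        rw [if_neg, mul_zero]
        intro h
        apply hy
        rw [h, siteConf, Function.update_self]
        show y = (slotConf (N.role N.source) none y).input 0
        rw [hrole]; rfl
      · intro h; exact absurd (Finset.mem_univ _) h
    · intro s _ hs
      refine Finset.sum_eq_zero fun y _ => ?_
      rw [memVec, Pi.single_eq_of_ne hs]; simp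
    · intro h; exact absurd (Finset.mem_univ _) h
  rw [hR]
  set y := (x N.source).input 0 with hy
  by_cases hx : x = siteConf N ⟨N.source, none⟩ y
  · rw [if_pos hx, mul_one, QAlgorithm.initState, Finset.prod_eq_single N.source]
    · have hxs : x N.source = slotConf Role.source none y := by
        rw [hx, siteConf, Function.update_self, hrole]
      rw [if_pos, if_pos rfl]
      · simp [hy]
      · rw [hxs, hrole]
        exact ⟨rfl, rfl, fun _ => rfl, fun _ => rfl⟩
    · intro v _ hv
      have hxv : x v = idleConf b (G.degree v) (N.role v) := by
        rw [hx, siteConf, Function.update_of_ne hv]; rfl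
      rw [if_pos, if_neg hv, if_pos]
      · rw [hxv]; intro k i; rfl
      · rw [hxv]
        refine ⟨?_, rfl, fun _ => rfl, fun _ => rfl⟩
        rw [Network.role, if_neg hv]
        split_ifs <;> rfl
    · intro h; exact absurd (Finset.mem_univ _) h
  · rw [if_neg hx, mul_zero]
    obtain ⟨v, hv⟩ := Function.ne_iff.1 hx
    refine Finset.prod_eq_zero (Finset.mem_univ v) ?_
    by_contra hne
    apply hv
    rw [← ne_eq, ite_ne_right_iff] at hne
    obtain ⟨⟨h1, h2, h3, h4⟩, hne⟩ := hne
    by_cases hvs : v = N.source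
    · subst hvs
      rw [siteConf, Function.update_self]
      show x N.source = slotConf (N.role N.source) none y
      rw [hrole] at h1 ⊢
      have hin : (x N.source).input = fun _ => y := by
        funext k; rw [hy, Subsingleton.elim k 0]
      have : x N.source = ⟨(x N.source).work, (x N.source).input, (x N.source).output,
        (x N.source).emit, (x N.source).recv⟩ := rfl
      rw [this, h1, h2, hin, funext h3, funext h4]
      rfl
    · rw [if_neg hvs, ite_ne_right_iff] at hne
      rw [siteConf, Function.update_of_ne hvs]
      have hin : (x v).input = fun _ _ => false := by
        funext k i; exact hne.1 k i
      have : x v = ⟨(x v).work, (x v).input, (x v).output, (x v).emit, (x v).recv⟩ := rfl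
      rw [this, h1, h2, hin, funext h3, funext h4, idleNet, Network.role, if_neg hvs]
      split_ifs <;> rfl

theorem state_eq (N : Network G) (φ : EuclideanSpace ℂ (Bits b)) (r : ℕ) :
    (walkAlgorithm b c hc R).state N φ r = walkerState b c hc R N φ (walkState N c r) := by
  induction r with
  | zero => exact initState_eq b c hc R N φ
  | succ r ih =>
    show (fun x => (walkAlgorithm b c hc R).localStep r
      ((walkAlgorithm b c hc R).state N φ r) ((walkAlgorithm b c hc R).deliver N x)) = _
    rw [ih, localStep_walkerState, sentState_deliver]
    rfl

theorem configCost_sentConf_le (N : Network G) (s : Site G) (y : Bits b) :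
    (walkAlgorithm b c hc R).configCost (sentConf N s y) ≤ b + 1 := by
  rw [QAlgorithm.configCost]
  obtain ⟨v, _ | i⟩ := s
  · rw [sentConf_none]
    rw [Finset.sum_eq_zero fun u _ => Finset.sum_eq_zero fun j _ => by
      rw [(siteConf_none_messages N v y u j).1]; rfl]
    exact Nat.zero_le _
  · rw [Fintype.sum_eq_single v, Fintype.sum_eq_single i]
    · rw [sentConf_some]
      simp [dataMsg, Msg.size]
    · intro j hj
      rw [sentConf_some]
      simp [hj, Msg.size, Msg.empty]
    · intro u hu
      refine Finset.sum_eq_zero fun j _ => ?_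
      have : (⟨u, some j⟩ : Site G) ≠ ⟨v, some i⟩ := fun e => hu (congrArg Sigma.fst e)
      rw [sentConf_some]
      simp only [if_neg this]
      rfl

/-- There is a single walker, so at most one message is sent in a round. -/
theorem messageComplexity_le (N : Network G) (φ : EuclideanSpace ℂ (Bits b)) :
    (walkAlgorithm b c hc R).messageComplexity N φ ≤ R * (b + 1) := by
  have h : ∀ r, (walkAlgorithm b c hc R).roundCost N φ r ≤ b + 1 := by
    intro r
    refine Finset.sup_le fun x hx => ?_
    have hx := (Finset.mem_filter.1 hx).2
    rw [state_eq, localStep_walkerState, sentState] at hx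
    obtain ⟨s, -, hs⟩ := Finset.exists_ne_zero_of_sum_ne_zero hx
    obtain ⟨y, -, hy⟩ := Finset.exists_ne_zero_of_sum_ne_zero hs
    have hxy : x = sentConf N s y := by
      by_contra hne
      exact hy (by rw [if_neg hne, mul_zero])
    rw [hxy]
    exact configCost_sentConf_le b c hc R N s y
  refine (Finset.sum_le_sum fun r _ => h r).trans ?_
  simp

/-- If the walker ends in the memory of `target`, then the data has been routed. -/
theorem solvesRouting_of_walkState (N : Network G) (hst : N.source ≠ N.target)
    {φ : EuclideanSpace ℂ (Bits b)} (hφ : ‖φ‖ = 1) {z : ℝ} (hz : |z| = 1)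
    (hw : walkState N c R = z • memVec N.target) {p : ℝ} (hp : p ≤ 1) :
    (walkAlgorithm b c hc R).SolvesRouting N φ p := by
  set conf : Bits b → ∀ v, WalkConf b (G.degree v) := siteConf N ⟨N.target, none⟩ with hconf
  have hfinal : ∀ x, (walkAlgorithm b c hc R).finalState N φ x =
      ∑ y, (z : ℂ) * φ y * if x = conf y then 1 else 0 := by
    intro x
    rw [QAlgorithm.finalState, state_eq, hw, walkerState, Finset.sum_eq_single ⟨N.target, none⟩]
    · simp [memVec, hconf]
    · intro s _ hs
      refine Finset.sum_eq_zero fun y _ => ?_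
      rw [memVec, Pi.smul_apply, Pi.single_eq_of_ne hs]; simp
    · intro h; exact absurd (Finset.mem_univ _) h
  have hinj : Function.Injective conf := siteConf_none_injective N N.target
  have hval : ∀ y, (walkAlgorithm b c hc R).finalState N φ (conf y) = z * φ y := by
    intro y
    rw [hfinal, Finset.sum_eq_single y]
    · rw [if_pos rfl, mul_one]
    · intro y' _ hy'
      rw [if_neg (fun e => hy' (hinj e).symm), mul_zero]
    · intro h; exact absurd (Finset.mem_univ _) h
  have hzero : ∀ x, (∀ y, x ≠ conf y) → (walkAlgorithm b c hc R).finalState N φ x = 0 := by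
    intro x hx
    rw [hfinal]
    exact Finset.sum_eq_zero fun y _ => by rw [if_neg (hx y), mul_zero]
  have htgt : ∀ y, conf y N.target =
      { idleNet b N N.target with output := some y } := by
    intro y
    rw [hconf, siteConf, Function.update_self]
    show slotConf (N.role N.target) none y = _
    rw [idleNet, role_target N hst]; rfl
  refine ⟨hp.trans (le_of_eq ?_), ?_⟩
  · have h1 : ∑ y, ‖φ y‖ ^ 2 = (walkAlgorithm b c hc R).successProb N φ := by
      refine Fintype.sum_of_injective conf hinj _ _ (fun x hx => ?_) fun y => ?_
      · rw [hzero x (fun y e => hx ⟨y, e.symm⟩)]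
        simp
      · rw [hval, if_pos (by rw [htgt]; rfl), norm_mul, Complex.norm_real, Real.norm_eq_abs, hz,
          one_mul]
    rw [← h1, ← EuclideanSpace.norm_sq_eq, hφ, one_pow]
  · refine ⟨fun x => if x = idleNet b N then (z : ℂ) else 0, fun x y hxy => ?_⟩
    have hiff : (walkAlgorithm b c hc R).eraseOutput N x = idleNet b N ↔ x = conf y := by
      constructor
      · intro h
        funext v
        have hv := congrFun h v
        by_cases hvt : v = N.target
        · subst hvt
          rw [QAlgorithm.eraseOutput, Function.update_self] at hv
          rw [htgt, ← hv, ← hxy]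
        · rw [QAlgorithm.eraseOutput, Function.update_of_ne hvt] at hv
          rw [hv, hconf, siteConf, Function.update_of_ne hvt]
      · rintro rfl
        funext v
        by_cases hvt : v = N.target
        · subst hvt
          rw [QAlgorithm.eraseOutput, Function.update_self, htgt]; rfl
        · rw [QAlgorithm.eraseOutput, Function.update_of_ne hvt, hconf, siteConf,
            Function.update_of_ne hvt]
    beta_reduce
    by_cases h : x = conf y
    · rw [if_pos (hiff.2 h), h, hval, mul_comm]
    · rw [if_neg (fun e => h (hiff.1 e)), mul_zero]
      refine hzero x fun y' e => ?_
      have : some y' = some y := by rw [← hxy, e, htgt]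
      exact h (by rw [e, Option.some_injective _ this])

end Network

/-! ### The columns of the welded trees -/

namespace WeldedNode

variable {n : ℕ}

theorem eq_of_val_eq {u v : WeldedNode n} (h1 : u.side = v.side)
    (h2 : (u.depth : ℕ) = v.depth) (h3 : (u.pos : ℕ) = v.pos) : u = v := by
  obtain ⟨s, d, p⟩ := u
  obtain ⟨s', d', p'⟩ := v
  obtain rfl : s = s' := h1
  obtain rfl : d = d' := Fin.ext h2
  obtain rfl : p = p' := Fin.ext h3
  rfl

/-- The two children of a node that is not a leaf. -/
def child (v : WeldedNode n) (h : (v.depth : ℕ) < n) (e : Fin 2) : WeldedNode n :=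
  ⟨v.side, ⟨v.depth + 1, by omega⟩, ⟨2 * v.pos + e, by
    have h1 := v.pos.2
    have h2 := e.2
    show _ < 2 ^ ((v.depth : ℕ) + 1)
    rw [pow_succ]; omega⟩⟩

/-- The parent of a node that is not a root. -/
def parent (v : WeldedNode n) (h : 0 < (v.depth : ℕ)) : WeldedNode n :=
  ⟨v.side, ⟨v.depth - 1, by omega⟩, ⟨v.pos / 2, by
    have h1 := v.pos.2
    have h2 : 2 ^ (v.depth : ℕ) = 2 ^ ((v.depth : ℕ) - 1) * 2 := by
      rw [← pow_succ, Nat.sub_add_cancel h]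
    show _ < 2 ^ ((v.depth : ℕ) - 1)
    omega⟩⟩

theorem isChild_iff_eq_child {v : WeldedNode n} (h : (v.depth : ℕ) < n) (w : WeldedNode n) :
    v.IsChild w ↔ w = v.child h 0 ∨ w = v.child h 1 := by
  constructor
  · rintro ⟨h1, h2, h3⟩
    rcases Nat.mod_two_eq_zero_or_one w.pos with hm | hm
    · exact Or.inl (eq_of_val_eq h1 h2 (by show (w.pos : ℕ) = 2 * v.pos + 0; omega))
    · exact Or.inr (eq_of_val_eq h1 h2 (by show (w.pos : ℕ) = 2 * v.pos + 1; omega))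
  · rintro (rfl | rfl)
    · exact ⟨rfl, rfl, by show (2 * (v.pos : ℕ) + 0) / 2 = v.pos; omega⟩
    · exact ⟨rfl, rfl, by show (2 * (v.pos : ℕ) + 1) / 2 = v.pos; omega⟩

theorem not_isChild_of_depth_eq {v : WeldedNode n} (h : (v.depth : ℕ) = n) (w : WeldedNode n) :
    ¬ v.IsChild w := by
  rintro ⟨-, h2, -⟩
  have := w.depth.2
  omega

theorem isChild_iff_eq_parent {v : WeldedNode n} (h : 0 < (v.depth : ℕ)) (w : WeldedNode n) :
    w.IsChild v ↔ w = v.parent h := by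
  constructor
  · rintro ⟨h1, h2, h3⟩
    exact eq_of_val_eq h1.symm (by show (w.depth : ℕ) = v.depth - 1; omega) h3.symm
  · rintro rfl
    exact ⟨rfl, by show (v.depth : ℕ) = v.depth - 1 + 1; omega, rfl⟩

theorem not_isChild_of_depth_eq_zero {v : WeldedNode n} (h : (v.depth : ℕ) = 0)
    (w : WeldedNode n) : ¬ w.IsChild v := by
  rintro ⟨-, h2, -⟩
  omega

theorem leaf_inj {s s' : Bool} {j j' : Fin (2 ^ n)} :
    leaf s j = leaf s' j' ↔ s = s' ∧ j = j' := by
  constructor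
  · intro h
    injection h with h1 _ h2
    exact ⟨h1, h2⟩
  · rintro ⟨rfl, rfl⟩; rfl

theorem exists_eq_leaf {v : WeldedNode n} (h : (v.depth : ℕ) = n) : ∃ j, v = leaf v.side j := by
  obtain ⟨s, d, p⟩ := v
  obtain rfl : d = Fin.last n := Fin.ext h
  exact ⟨p, rfl⟩

/-- The column of a node: its distance from the root of the left tree. -/
def column (v : WeldedNode n) : ℕ := if v.side then 2 * n + 1 - v.depth else v.depth

end WeldedNode

section Welded

open WeldedNode

variable {n : ℕ} {ℓ r : Equiv.Perm (Fin (2 ^ n))}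

/-- The edges of the cycle, directed along it. -/
def IsWeld (ℓ r : Equiv.Perm (Fin (2 ^ n))) (u v : WeldedNode n) : Prop :=
  (∃ i, u = leaf false (ℓ i) ∧ v = leaf true (r i)) ∨
    (∃ i, u = leaf true (r i) ∧ v = leaf false (ℓ (i + 1)))

theorem weldedTrees_adj_iff (u v : WeldedNode n) :
    (weldedTrees n ℓ r).Adj u v ↔
      u.IsChild v ∨ v.IsChild u ∨ IsWeld ℓ r u v ∨ IsWeld ℓ r v u := by
  rw [weldedTrees, SimpleGraph.fromRel_adj]
  have hirr : u = v → ¬ (u.IsChild v ∨ v.IsChild u ∨ IsWeld ℓ r u v ∨ IsWeld ℓ r v u) := by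
    rintro rfl (h | h | (⟨i, h1, h2⟩ | ⟨i, h1, h2⟩) | (⟨i, h1, h2⟩ | ⟨i, h1, h2⟩))
    · exact absurd h.2.1 (by omega)
    · exact absurd h.2.1 (by omega)
    all_goals
      rw [h1, leaf_inj] at h2
      exact absurd h2.1 (by decide)
  constructor
  · rintro ⟨-, (h | h) | (h | h)⟩
    · exact Or.inl h
    · exact Or.inr (Or.inr (Or.inl h))
    · exact Or.inr (Or.inl h)
    · exact Or.inr (Or.inr (Or.inr h))
  · intro h
    refine ⟨fun e => hirr e h, ?_⟩
    rcases h with h | h | h | h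
    · exact Or.inl (Or.inl h)
    · exact Or.inr (Or.inl h)
    · exact Or.inl (Or.inr h)
    · exact Or.inr (Or.inr h)

theorem not_isWeld_of_depth_lt {v : WeldedNode n} (h : (v.depth : ℕ) < n) (w : WeldedNode n) :
    ¬ IsWeld ℓ r v w ∧ ¬ IsWeld ℓ r w v := by
  have : ∀ s j, v ≠ leaf s j := by
    rintro s j rfl
    exact absurd h (lt_irrefl n)
  constructor
  · rintro (⟨i, h1, -⟩ | ⟨i, h1, -⟩) <;> exact this _ _ h1
  · rintro (⟨i, -, h1⟩ | ⟨i, -, h1⟩) <;> exact this _ _ h1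

theorem isWeld_leaf_false_iff (j : Fin (2 ^ n)) (w : WeldedNode n) :
    IsWeld ℓ r (leaf false j) w ∨ IsWeld ℓ r w (leaf false j) ↔
      w = leaf true (r (ℓ.symm j)) ∨ w = leaf true (r (ℓ.symm j - 1)) := by
  simp only [IsWeld, leaf_inj]
  constructor
  · rintro ((⟨i, ⟨-, rfl⟩, rfl⟩ | ⟨i, ⟨h, -⟩, -⟩) | (⟨i, -, ⟨h, -⟩⟩ | ⟨i, rfl, ⟨-, rfl⟩⟩))
    · left; simp
    · exact absurd h (by decide)
    · exact absurd h (by decide)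
    · right; simp
  · rintro (rfl | rfl)
    · exact Or.inl (Or.inl ⟨ℓ.symm j, ⟨trivial, by simp⟩, rfl⟩)
    · exact Or.inr (Or.inr ⟨ℓ.symm j - 1, rfl, trivial, by simp⟩)

theorem isWeld_leaf_true_iff (j : Fin (2 ^ n)) (w : WeldedNode n) :
    IsWeld ℓ r (leaf true j) w ∨ IsWeld ℓ r w (leaf true j) ↔
      w = leaf false (ℓ (r.symm j)) ∨ w = leaf false (ℓ (r.symm j + 1)) := by
  simp only [IsWeld, leaf_inj]
  constructor
  · rintro ((⟨i, ⟨h, -⟩, -⟩ | ⟨i, ⟨-, rfl⟩, rfl⟩) | (⟨i, rfl, ⟨-, rfl⟩⟩ | ⟨i, -, ⟨h, -⟩⟩))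
    · exact absurd h (by decide)
    · right; simp
    · left; simp
    · exact absurd h (by decide)
  · rintro (rfl | rfl)
    · exact Or.inr (Or.inl ⟨r.symm j, rfl, trivial, by simp⟩)
    · exact Or.inl (Or.inr ⟨r.symm j, ⟨trivial, by simp⟩, rfl⟩)

theorem Fin.two_pow_one_ne_zero (hn : 1 ≤ n) : (1 : Fin (2 ^ n)) ≠ 0 := by
  have h : 1 < 2 ^ n := Nat.one_lt_two_pow (by omega)
  intro e
  have := congrArg Fin.val e
  rw [Fin.val_zero, Fin.val_one', Nat.mod_eq_of_lt h] at this
  omega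

theorem child_zero_ne_child_one {v : WeldedNode n} (h : (v.depth : ℕ) < n) :
    v.child h 0 ≠ v.child h 1 := by
  intro e
  have : ((v.child h 0).pos : ℕ) = (v.child h 1).pos := by rw [e]
  have h' : 2 * (v.pos : ℕ) + 0 = 2 * v.pos + 1 := this
  omega

theorem parent_ne_child {v : WeldedNode n} (h0 : 0 < (v.depth : ℕ)) (h : (v.depth : ℕ) < n)
    (e : Fin 2) : v.parent h0 ≠ v.child h e := by
  intro he
  have : ((v.parent h0).depth : ℕ) = (v.child h e).depth := by rw [he]
  have h' : (v.depth : ℕ) - 1 = v.depth + 1 := this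
  omega

theorem parent_ne_leaf {v : WeldedNode n} (h0 : 0 < (v.depth : ℕ)) {s : Bool} (hs : v.side ≠ s)
    (j : Fin (2 ^ n)) : v.parent h0 ≠ leaf s j := fun he => hs (congrArg WeldedNode.side he)

theorem neighborFinset_root {v : WeldedNode n} (h0 : (v.depth : ℕ) = 0)
    (h : (v.depth : ℕ) < n) :
    (weldedTrees n ℓ r).neighborFinset v = {v.child h 0, v.child h 1} := by
  ext w
  have h1 := not_isWeld_of_depth_lt (ℓ := ℓ) (r := r) h w
  simp only [SimpleGraph.mem_neighborFinset, weldedTrees_adj_iff, h1.1, h1.2,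
    isChild_iff_eq_child h, not_isChild_of_depth_eq_zero h0, or_false, Finset.mem_insert,
    Finset.mem_singleton]

theorem neighborFinset_inner {v : WeldedNode n} (h0 : 0 < (v.depth : ℕ))
    (h : (v.depth : ℕ) < n) :
    (weldedTrees n ℓ r).neighborFinset v = {v.parent h0, v.child h 0, v.child h 1} := by
  ext w
  have h1 := not_isWeld_of_depth_lt (ℓ := ℓ) (r := r) h w
  simp only [SimpleGraph.mem_neighborFinset, weldedTrees_adj_iff, h1.1, h1.2,
    isChild_iff_eq_child h, isChild_iff_eq_parent h0, or_false, Finset.mem_insert,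
    Finset.mem_singleton]
  tauto

theorem neighborFinset_leaf_false (j : Fin (2 ^ n))
    (h0 : 0 < ((leaf false j).depth : ℕ)) :
    (weldedTrees n ℓ r).neighborFinset (leaf false j) =
      {(leaf false j).parent h0, leaf true (r (ℓ.symm j)), leaf true (r (ℓ.symm j - 1))} := by
  ext w
  simp only [SimpleGraph.mem_neighborFinset, weldedTrees_adj_iff, isWeld_leaf_false_iff,
    not_isChild_of_depth_eq (show ((leaf false j).depth : ℕ) = n from rfl),
    isChild_iff_eq_parent h0, false_or, Finset.mem_insert, Finset.mem_singleton]

theorem neighborFinset_leaf_true (j : Fin (2 ^ n))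
    (h0 : 0 < ((leaf true j).depth : ℕ)) :
    (weldedTrees n ℓ r).neighborFinset (leaf true j) =
      {(leaf true j).parent h0, leaf false (ℓ (r.symm j)), leaf false (ℓ (r.symm j + 1))} := by
  ext w
  simp only [SimpleGraph.mem_neighborFinset, weldedTrees_adj_iff, isWeld_leaf_true_iff,
    not_isChild_of_depth_eq (show ((leaf true j).depth : ℕ) = n from rfl),
    isChild_iff_eq_parent h0, false_or, Finset.mem_insert, Finset.mem_singleton]

theorem avgOp_eq_sum_neighborFinset {V : Type} [Fintype V] {G : SimpleGraph V}
    [DecidableRel G.Adj] (N : Network G) (h : V → ℝ) (v : V) :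
    avgOp N h v = (∑ w ∈ G.neighborFinset v, h w) / (G.neighborFinset v).card := by
  rw [avgOp_apply, SimpleGraph.card_neighborFinset_eq_degree]
  congr 1
  rw [Equiv.sum_comp (N.port v) (fun w : G.neighborSet v => h w), SimpleGraph.neighborFinset,
    ← Finset.sum_set_coe]

theorem avgOp_of_pair {V : Type} [Fintype V] [DecidableEq V] {G : SimpleGraph V}
    [DecidableRel G.Adj] (N : Network G) (h : V → ℝ) {v x y : V}
    (hv : G.neighborFinset v = {x, y}) (hxy : x ≠ y) : avgOp N h v = (h x + h y) / 2 := by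
  rw [avgOp_eq_sum_neighborFinset, hv, Finset.sum_pair hxy, Finset.card_pair hxy]
  norm_num

theorem avgOp_of_triple {V : Type} [Fintype V] [DecidableEq V] {G : SimpleGraph V}
    [DecidableRel G.Adj] (N : Network G) (h : V → ℝ) {v x y z : V}
    (hv : G.neighborFinset v = {x, y, z}) (hxy : x ≠ y) (hxz : x ≠ z) (hyz : y ≠ z) :
    avgOp N h v = (h x + h y + h z) / 3 := by
  have hx : x ∉ ({y, z} : Finset V) := by simp [hxy, hxz]
  rw [avgOp_eq_sum_neighborFinset, hv, Finset.sum_insert hx, Finset.sum_pair hyz,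
    Finset.card_insert_of_notMem hx, Finset.card_pair hyz]
  norm_num
  ring

/-- The walk on the welded trees projects to the chain on the columns. -/
theorem avgOp_column (hn : 1 ≤ n) (N : Network (weldedTrees n ℓ r)) (H : ℕ → ℝ) :
    avgOp N (fun v => H v.column) = fun v => colOp n H v.column := by
  funext v
  have hd := v.depth.2
  rw [colOp_apply]
  rcases Nat.eq_zero_or_pos v.depth with h0 | h0
  · have h : (v.depth : ℕ) < n := by omega
    rw [avgOp_of_pair N _ (neighborFinset_root h0 h) (child_zero_ne_child_one h)]
    cases hs : v.side
    · have e : ∀ e, (v.child h e).column = 1 := fun e => by simp [column, child, hs, h0]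
      have ev : v.column = 0 := by simp [column, hs, h0]
      rw [e, e, ev]; simp [stepDown, stepUp]
    · have e : ∀ e, (v.child h e).column = 2 * n := fun e => by simp [column, child, hs, h0]
      have ev : v.column = 2 * n + 1 := by simp [column, hs, h0]
      have e1 : stepDown n (2 * n + 1) = 1 := by
        unfold stepDown
        rw [if_neg (by omega), if_neg (by omega), if_neg (by omega), if_pos rfl]
      have e2 : stepUp n (2 * n + 1) = 0 := by
        unfold stepUp
        rw [if_neg (by omega), if_neg (by omega), if_neg (by omega)]
      rw [e, e, ev, e1, e2, Nat.add_sub_cancel]; ring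
  · rcases Nat.lt_or_ge v.depth n with h | h
    · rw [avgOp_of_triple N _ (neighborFinset_inner h0 h) (parent_ne_child h0 h 0)
        (parent_ne_child h0 h 1) (child_zero_ne_child_one h)]
      cases hs : v.side
      · have e : ∀ e, (v.child h e).column = v.depth + 1 := fun e => by simp [column, child, hs]
        have ep : (v.parent h0).column = v.depth - 1 := by simp [column, parent, hs]
        have ev : v.column = v.depth := by simp [column, hs]
        have e1 : stepDown n v.depth = 1 / 3 := by
          unfold stepDown; rw [if_neg (by omega), if_pos (by omega)]
        have e2 : stepUp n v.depth = 2 / 3 := by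
          unfold stepUp; rw [if_neg (by omega), if_pos (by omega)]
        rw [e, e, ep, ev, e1, e2]; ring
      · have e : ∀ e, (v.child h e).column = 2 * n + 1 - v.depth - 1 := fun e => by
          simp only [column, child, hs, if_true]; omega
        have ep : (v.parent h0).column = 2 * n + 1 - v.depth + 1 := by
          simp only [column, parent, hs, if_true]; omega
        have ev : v.column = 2 * n + 1 - v.depth := by simp [column, hs]
        have e1 : stepDown n (2 * n + 1 - v.depth) = 2 / 3 := by
          unfold stepDown; rw [if_neg (by omega), if_neg (by omega), if_pos (by omega)]
        have e2 : stepUp n (2 * n + 1 - v.depth) = 1 / 3 := by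
          unfold stepUp; rw [if_neg (by omega), if_neg (by omega), if_pos (by omega)]
        rw [e, e, ep, ev, e1, e2]; ring
    · have h' : (v.depth : ℕ) = n := by omega
      obtain ⟨j, hj⟩ := exists_eq_leaf h'
      have h1 := Fin.two_pow_one_ne_zero hn
      cases hs : v.side
      · rw [hs] at hj
        subst hj
        rw [avgOp_of_triple N _ (neighborFinset_leaf_false j h0)
          (parent_ne_leaf h0 (by simp [leaf]) _) (parent_ne_leaf h0 (by simp [leaf]) _)
          (fun e => h1 (by
            have := r.injective (leaf_inj.1 e).2
            rwa [eq_comm, sub_eq_self] at this))]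
        have e : ∀ j : Fin (2 ^ n), (leaf true j).column = n + 1 := fun j => by
          simp only [column, leaf, if_true, Fin.val_last]; omega
        have ep : ((leaf false j).parent h0).column = n - 1 := by simp [column, parent, leaf]
        have ev : (leaf false j).column = n := by simp [column, leaf]
        have e1 : stepDown n n = 1 / 3 := by
          unfold stepDown; rw [if_neg (by omega), if_pos (by omega)]
        have e2 : stepUp n n = 2 / 3 := by
          unfold stepUp; rw [if_neg (by omega), if_pos (by omega)]
        rw [e, e, ep, ev, e1, e2]; ring
      · rw [hs] at hj
        subst hj
        rw [avgOp_of_triple N _ (neighborFinset_leaf_true j h0)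
          (parent_ne_leaf h0 (by simp [leaf]) _) (parent_ne_leaf h0 (by simp [leaf]) _)
          (fun e => h1 (by
            have := ℓ.injective (leaf_inj.1 e).2
            rwa [eq_comm, add_eq_left] at this))]
        have e : ∀ j : Fin (2 ^ n), (leaf false j).column = n + 1 - 1 := fun j => by
          simp [column, leaf]
        have ep : ((leaf true j).parent h0).column = n + 1 + 1 := by
          simp only [column, parent, leaf, if_true, Fin.val_last]; omega
        have ev : (leaf true j).column = n + 1 := by
          simp only [column, leaf, if_true, Fin.val_last]; omega
        have e1 : stepDown n (n + 1) = 2 / 3 := by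
          unfold stepDown; rw [if_neg (by omega), if_neg (by omega), if_pos (by omega)]
        have e2 : stepUp n (n + 1) = 1 / 3 := by
          unfold stepUp; rw [if_neg (by omega), if_neg (by omega), if_pos (by omega)]
        rw [e, e, ep, ev, e1, e2]; ring

theorem aeval_avgOp_column (hn : 1 ≤ n) (N : Network (weldedTrees n ℓ r)) (p : ℝ[X])
    (H : ℕ → ℝ) :
    aeval (avgOp N) p (fun v => H v.column) = fun v => aeval (colOp n) p H v.column := by
  induction p using Polynomial.induction_on' with
  | add p q hp hq =>
    rw [map_add, LinearMap.add_apply, hp, hq]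
    funext v
    simp
  | monomial k a =>
    have hpow : ((avgOp N) ^ k) (fun v => H v.column) = fun v => ((colOp n) ^ k) H v.column := by
      induction k with
      | zero => rfl
      | succ k ih =>
        rw [pow_succ', Module.End.mul_apply, ih, avgOp_column hn, pow_succ']; rfl
    simp only [aeval_monomial, Algebra.algebraMap_eq_smul_one, smul_mul_assoc, one_mul,
      LinearMap.smul_apply, hpow]
    rfl

theorem column_eq_zero_iff (v : WeldedNode n) : v.column = 0 ↔ v = root n false := by
  constructor
  · intro h
    have hd := v.depth.2
    cases hs : v.side
    · have h0 : (v.depth : ℕ) = 0 := by simpa [column, hs] using h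
      refine eq_of_val_eq hs h0 ?_
      have := v.pos.2
      show (v.pos : ℕ) = 0
      have h1 : 2 ^ (v.depth : ℕ) = 1 := by rw [h0, pow_zero]
      omega
    · rw [column, hs, if_pos rfl] at h
      omega
  · rintro rfl
    rfl

theorem degree_root (hn : 1 ≤ n) (s : Bool) : (weldedTrees n ℓ r).degree (root n s) = 2 := by
  have h : ((root n s).depth : ℕ) < n := hn
  rw [← SimpleGraph.card_neighborFinset_eq_degree, neighborFinset_root rfl h,
    Finset.card_pair (child_zero_ne_child_one h)]

/-- The amplitude with which the walk of `t` steps goes from the ports of `source` to those of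
`target`. -/
theorem weldedTrees_amplitude (hn : 1 ≤ n) (N : Network (weldedTrees n ℓ r))
    (hN : IsWeldedNetwork N) {t : ℕ} (ht : 1 ≤ t) :
    portVec N.target ⬝ᵥ walkOp N (t - 1) (portVec N.source) =
      (-1) ^ (t - 1) * hitAmplitude n t := by
  rw [portVec_dotProduct_walkOp, Nat.sub_add_cancel ht]
  · congr 1
    have h : (Pi.single N.source 1 : WeldedNode n → ℝ) =
        fun v => (Pi.single 0 1 : ℕ → ℝ) v.column := by
      funext v
      by_cases hv : v = N.source
      · rw [(column_eq_zero_iff v).2 (hv.trans hN.1), hv, Pi.single_eq_same, Pi.single_eq_same]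
      · rw [Pi.single_eq_of_ne hv,
          Pi.single_eq_of_ne (fun e => hv (((column_eq_zero_iff v).1 e).trans hN.1.symm))]
    rw [h, aeval_avgOp_column hn, hN.2]
    rfl
  · rw [hN.1, hN.2, degree_root hn, degree_root hn]
  · rw [hN.2, degree_root hn]; norm_num

end Welded

/-! ### Parameters of the algorithm -/

/-- The parameters of the algorithm for trees of height `n`: the number of steps of a walk, the
number of iterations of the amplification, and the angle that adjusts the initial amplitude. -/
theorem exists_parameters (n : ℕ) (hn : 1 ≤ n) : ∃ (t k : ℕ) (γ : ℝ), 1 ≤ t ∧ 1 ≤ k ∧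
    (2 * k + 1) * t + 1 ≤ 252730 * n ^ 5 ∧
    Real.sin γ * ((-1) ^ (t - 1) * hitAmplitude n t) =
      Real.sin (Real.pi / (2 * (2 * k + 1))) := by
  obtain ⟨t, ht1, ht2, ha⟩ := exists_hitAmplitude_ge hn
  have hn' : (1 : ℝ) ≤ n := by exact_mod_cast hn
  set k := 16848 * n ^ 4 with hk
  have hk1 : 1 ≤ k := by rw [hk]; exact Nat.mul_pos (by norm_num) (pow_pos hn 4)
  have hk' : (1 : ℝ) ≤ k := by exact_mod_cast hk1
  set a := (-1 : ℝ) ^ (t - 1) * hitAmplitude n t with hadef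
  have habs : 1 / (k : ℝ) ≤ |a| := by
    rw [hadef, abs_mul, abs_pow, abs_neg, abs_one, one_pow, one_mul, hk]
    push_cast
    exact ha
  have ha0 : a ≠ 0 := by
    intro h
    rw [h, abs_zero] at habs
    have : (0 : ℝ) < 1 / k := by positivity
    linarith
  set s := Real.sin (Real.pi / (2 * (2 * k + 1))) with hs
  have hpi := Real.pi_pos
  have hang : Real.pi / (2 * (2 * k + 1)) ≤ 1 / k := by
    rw [div_le_div_iff₀ (by positivity) (by positivity)]
    nlinarith [Real.pi_le_four]
  have hang0 : 0 < Real.pi / (2 * (2 * (k : ℝ) + 1)) := by positivity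
  have hs0 : 0 ≤ s := by
    refine Real.sin_nonneg_of_nonneg_of_le_pi hang0.le (hang.trans ?_)
    have : 1 / (k : ℝ) ≤ 1 := by rw [div_le_one (by positivity)]; exact hk'
    linarith [Real.pi_gt_three]
  have hs1 : s ≤ |a| := (Real.sin_le hang0.le).trans (hang.trans habs)
  have hquot : |s / a| ≤ 1 := by
    rw [abs_div, abs_of_nonneg hs0, div_le_one (abs_pos.2 ha0)]
    exact hs1
  refine ⟨t, k, Real.arcsin (s / a), ht1, hk1, ?_, ?_⟩
  · have h1 : t ≤ 5 * n := by omega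
    have h2 : n ≤ n ^ 5 := Nat.le_self_pow (by norm_num) n
    calc (2 * k + 1) * t + 1 ≤ (2 * k + 1) * (5 * n) + 1 := by gcongr
      _ = 168480 * n ^ 5 + 5 * n + 1 := by rw [hk]; ring
      _ ≤ 252730 * n ^ 5 := by omega
  · rw [Real.sin_arcsin (neg_le_of_abs_le hquot) (le_of_abs_le hquot), div_mul_cancel₀ _ ha0]

/-- The same algorithms route classical and quantum data, from a single copy and with certainty. -/
theorem exists_routing_algorithms : ∃ A : ∀ _n b : ℕ, QAlgorithm b, ∀ n b : ℕ, 1 ≤ n → 1 ≤ b →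
    (A n b).copies = 1 ∧
    ∀ (ℓ r : Equiv.Perm (Fin (2 ^ n))) (N : Network (weldedTrees n ℓ r)), IsWeldedNetwork N →
      ∀ φ : EuclideanSpace ℂ (Bits b), ‖φ‖ = 1 →
        (∀ p ≤ (1 : ℝ), (A n b).SolvesRouting N φ p) ∧
        (A n b).messageComplexity N φ ≤ 505460 * (b * n ^ 5) := by
  choose! t k γ h using exists_parameters
  refine ⟨fun n b => walkAlgorithm b (schedule (t n) (k n) (γ n))
    (isReflectionData_schedule (t n) (k n) (γ n)) ((2 * k n + 1) * t n + 1),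
    fun n b hn hb => ⟨rfl, fun ℓ r N hN φ hφ => ⟨fun p hp => ?_, ?_⟩⟩⟩
  · obtain ⟨ht, hk, -, hγ⟩ := h n hn
    have hst : N.source ≠ N.target := by
      rw [hN.1, hN.2]
      exact fun e => Bool.false_ne_true (congrArg WeldedNode.side e)
    refine solvesRouting_of_walkState b _ _ _ N hst hφ (z := (-1) ^ k n) (by simp) ?_ hp
    refine walkState_final N hst ?_ ?_ ht hk ?_
    · rw [hN.1, degree_root hn]; norm_num
    · rw [hN.2, degree_root hn]; norm_num
    · rw [weldedTrees_amplitude hn N hN ht]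
      exact hγ
  · obtain ⟨-, -, hR, -⟩ := h n hn
    refine (messageComplexity_le b _ _ _ N φ).trans ?_
    calc ((2 * k n + 1) * t n + 1) * (b + 1) ≤ 252730 * n ^ 5 * (2 * b) := by
          gcongr
          omega
      _ = 505460 * (b * n ^ 5) := by ring

theorem theorem1 :
    -- classical data: `source` receives the `b`-bit string `x` once
    (∃ (A : ∀ _n b : ℕ, QAlgorithm b) (C k : ℕ), ∀ n b : ℕ, 1 ≤ n → 1 ≤ b →
      (A n b).copies = 1 ∧
      ∀ (ℓ r : Equiv.Perm (Fin (2 ^ n))) (N : Network (weldedTrees n ℓ r)), IsWeldedNetwork N →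
        ∀ x : Bits b,
          (A n b).SolvesRouting N (EuclideanSpace.single x 1) (1 - 1 / Real.exp n) ∧
          (A n b).messageComplexity N (EuclideanSpace.single x 1) ≤ C * (b * n ^ k)) ∧
    -- quantum data: `source` receives polynomially many copies of the `b`-qubit state `φ`
    (∃ (A : ∀ _n b : ℕ, QAlgorithm b) (C k : ℕ), ∀ n b : ℕ, 1 ≤ n → 1 ≤ b →
      (A n b).copies ≤ C * n ^ k ∧
      ∀ (ℓ r : Equiv.Perm (Fin (2 ^ n))) (N : Network (weldedTrees n ℓ r)), IsWeldedNetwork N →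
        ∀ φ : EuclideanSpace ℂ (Bits b), ‖φ‖ = 1 →
          (A n b).SolvesRouting N φ (1 - 1 / Real.exp n) ∧
          (A n b).messageComplexity N φ ≤ C * (b * n ^ k)) := by
  obtain ⟨A, hA⟩ := exists_routing_algorithms
  have hp : ∀ n : ℕ, 1 - 1 / Real.exp n ≤ 1 := fun n => by
    have : 0 ≤ 1 / Real.exp n := by positivity
    linarith
  refine ⟨⟨A, 505460, 5, fun n b hn hb => ?_⟩, ⟨A, 505460, 5, fun n b hn hb => ?_⟩⟩
  · obtain ⟨hc, h⟩ := hA n b hn hb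
    refine ⟨hc, fun ℓ r N hN x => ?_⟩
    obtain ⟨h1, h2⟩ := h ℓ r N hN (EuclideanSpace.single x 1) (by simp)
    exact ⟨h1 _ (hp n), h2⟩
  · obtain ⟨hc, h⟩ := hA n b hn hb
    refine ⟨?_, fun ℓ r N hN φ hφ => ?_⟩
    · rw [hc]
      exact Nat.mul_pos (by norm_num) (pow_pos hn 5)
    · obtain ⟨h1, h2⟩ := h ℓ r N hN φ hφ
      exact ⟨h1 _ (hp n), h2⟩
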